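/- Let $\mathcal T=\mathbb R/2\pi\mathbb Z$ and let $\rho_0$ be a Borel probability measure on $\mathcal T$. Let $(\rho(t))_{t\ge 0}$ be a measure-valued weak solution, with initial datum $\rho_0$, of the kinetic Kuramoto equation for identical oscillators $$\partial_t\rho+\partial_\vartheta(v\rho)=0,\qquad v(t,\vartheta)=-\int_{\mathcal T}\sin(\vartheta-\vartheta')\,\rho(t,d\vartheta'),$$ that is: $\rho(t)$ is a probability measure on $\mathcal T$ for every $t\ge 0$, and there are characteristics $\Theta(t,\cdot):\mathcal T\to\mathcal T$ and order parameters $R(t)\ge 0$, $\varphi(t)\in\mathcal T$ such that for all $t\ge0$ $$\dot\Theta(t,\vartheta)=-R(t)\sin(\Theta(t,\vartheta)-\varphi(t)),\quad \Theta(0,\vartheta)=\vartheta\qquad\text{for all }\vartheta\in\mathcal T,$$ $$R(t)e^{i\varphi(t)}=\int_{\mathcal T}e^{i\vartheta}\,\rho(t,d\vartheta),\qquad \int_{\mathcal T}h(\vartheta)\,\rho(t,d\vartheta)=\int_{\mathcal T}h(\Theta(t,\vartheta))\,\rho_0(d\vartheta)$$ for every smooth $2\pi$-periodic $h$. Assume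 that $R$ is not identically zero on $[0,\infty)$ (this holds in particular for every non-stationary solution). Then $R(t)>0$ for all $t\ge 0$, so that $\varphi(t)$ is well defined mod $2\pi$; $\varphi$ has a continuous real-valued branch on $[0,\infty)$, which converges to a finite limit $\varphi^*\in\mathbb R$ as $t\to+\infty$; and there is a point $\alpha\in\mathcal T$ such that, mod $2\pi$, $$\lim_{t\to+\infty}\Theta(t,\vartheta)=\begin{cases}\varphi^* & \text{for every }\vartheta\in\mathcal T\setminus\{\alpha\},\\ \varphi^*+\pi & \text{for }\vartheta=\alpha.\end{cases}$$ -/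

import Mathlib

open MeasureTheory Filter Topology Set
open scoped ContDiff

/-- The torus `ℝ / 2πℤ` (`Real.Angle`) with its Borel σ-algebra. -/
noncomputable instance instMeasurableSpaceRealAngle : MeasurableSpace Real.Angle := borel Real.Angle

instance instBorelSpaceRealAngle : BorelSpace Real.Angle := ⟨rfl⟩

/-- A regular (smooth) observable on the torus: its `2π`-periodic lift to `ℝ` is `C^∞`. -/
def IsRegularObservable (h : Real.Angle → ℝ) : Prop :=
  ContDiff ℝ ∞ (fun x : ℝ => h (x : Real.Angle))

/-- `x : [0, ∞) → 𝒯` solves `x' = - R(t) sin (x - φ(t))` on the torus: some real-valued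
lift of `x` solves this equation (with the one-sided derivative at `t = 0`). -/
def IsCharacteristic (R : ℝ → ℝ) (φ : ℝ → Real.Angle) (x : ℝ → Real.Angle) : Prop :=
  ∃ γ : ℝ → ℝ, (∀ t, 0 ≤ t → (γ t : Real.Angle) = x t) ∧
    ∀ t, 0 ≤ t →
      HasDerivWithinAt γ (-(R t * Real.Angle.sin ((γ t : Real.Angle) - φ t))) (Ici 0) t

/-- Measure-valued weak solution, on `t ≥ 0`, of the kinetic Kuramoto equation for identical
oscillators (natural frequency `0`, coupling `1`) with initial datum `ρ₀`, together with its
characteristics `Θ` and order parameters `R`, `φ`. The phase `φ t` is not constrained by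
`order_parameter` when `R t = 0`. -/
structure IsKineticKuramotoSolution (ρ₀ : Measure Real.Angle) (ρ : ℝ → Measure Real.Angle)
    (Θ : ℝ → Real.Angle → Real.Angle) (R : ℝ → ℝ) (φ : ℝ → Real.Angle) : Prop where
  isProbabilityMeasure : ∀ t, 0 ≤ t → IsProbabilityMeasure (ρ t)
  initial : ∀ ϑ, Θ 0 ϑ = ϑ
  characteristic : ∀ ϑ, IsCharacteristic R φ (fun t => Θ t ϑ)
  R_nonneg : ∀ t, 0 ≤ t → 0 ≤ R t
  order_parameter : ∀ t, 0 ≤ t →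
    (R t : ℂ) * ((φ t).toCircle : ℂ) = ∫ ϑ, (ϑ.toCircle : ℂ) ∂(ρ t)
  transport : ∀ t, 0 ≤ t → ∀ h : Real.Angle → ℝ, IsRegularObservable h →
    ∫ ϑ, h ϑ ∂(ρ t) = ∫ ϑ, h (Θ t ϑ) ∂ρ₀

/-! ### Calculus on half-lines -/

/-! Write the mean field as `(X, Y) = R (cos φ, sin φ)`. Along the flow `R²` increases at the rate
`2 ∫ R² sin² (γ - φ)`, so it is a bounded Lyapunov function. By Barbalat's lemma the rate tends to
`0`, and by Cauchy–Schwarz so does the velocity of the mean field. No decay rate is available, so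
this alone does not make `φ` converge.

At a late time some particle `r` has `R cos (γ r - φ)` bounded below, because the average of this
quantity is `R²`. The field then moves too slowly for `r` to lose this alignment, and `R sin (γ r -
φ) → 0`.

Seen from `r`, every other particle becomes a linear problem: with `δ = γ p - γ r`, the quantity `y
= cot (δ / 2)` solves `y' = c y - s`, where `c = R cos (γ r - φ)` and `s = R sin (γ r - φ)`. Since
`c` is eventually bounded below by a positive constant and `s → 0`, exactly one initial value `L`
leads to `y → 0`, that is `δ → π`; all others lead to `y → ±∞`, that is `δ → 0` mod `2π`. The
particle starting at `L` is `α`.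

Finally, the interaction is odd, so the mean phase is conserved. All relative phases converge, hence
so does their mean, hence so does `γ r`; and `φ` follows `γ r` up to a multiple of `2π`. -/

theorem monotoneOn_Ici_of_hasDerivAt_nonneg {f f' : ℝ → ℝ} {a : ℝ} (hc : ContinuousOn f (Ici a))
    (hd : ∀ t, a < t → HasDerivAt f (f' t) t) (h0 : ∀ t, a < t → 0 ≤ f' t) :
    MonotoneOn f (Ici a) := by
  refine monotoneOn_of_hasDerivWithinAt_nonneg (convex_Ici a) hc
    (f' := f') ?_ ?_
  · intro x hx
    rw [interior_Ici] at hx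
    exact (hd x hx).hasDerivWithinAt
  · intro x hx
    rw [interior_Ici] at hx
    exact h0 x hx

theorem antitoneOn_Ici_of_hasDerivAt_nonpos {f f' : ℝ → ℝ} {a : ℝ} (hc : ContinuousOn f (Ici a))
    (hd : ∀ t, a < t → HasDerivAt f (f' t) t) (h0 : ∀ t, a < t → f' t ≤ 0) :
    AntitoneOn f (Ici a) := by
  refine antitoneOn_of_hasDerivWithinAt_nonpos (convex_Ici a) hc
    (f' := f') ?_ ?_
  · intro x hx
    rw [interior_Ici] at hx
    exact (hd x hx).hasDerivWithinAt
  · intro x hx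
    rw [interior_Ici] at hx
    exact h0 x hx

theorem eq_of_hasDerivAt_zero_Ioi {f : ℝ → ℝ} {a t : ℝ} (hc : ContinuousOn f (Ici a))
    (hd : ∀ t, a < t → HasDerivAt f 0 t) (ht : a ≤ t) : f t = f a :=
  le_antisymm
    (antitoneOn_Ici_of_hasDerivAt_nonpos hc hd (fun _ _ => le_rfl) self_mem_Ici ht ht)
    (monotoneOn_Ici_of_hasDerivAt_nonneg hc hd (fun _ _ => le_rfl) self_mem_Ici ht ht)

theorem exists_antiderivative {a : ℝ → ℝ} (ha : Continuous a) :
    ∃ A : ℝ → ℝ, A 0 = 0 ∧ ∀ t, HasDerivAt A (a t) t :=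
  ⟨fun t => ∫ τ in (0 : ℝ)..t, a τ, by simp, fun t =>
    intervalIntegral.integral_hasDerivAt_right (ha.intervalIntegrable _ _)
      (ha.stronglyMeasurableAtFilter _ _) ha.continuousAt⟩

/-- A solution of a homogeneous linear equation that starts nonzero stays nonzero. -/
theorem ne_zero_of_hasDerivAt_mul {f a : ℝ → ℝ} (hf : Continuous f) (ha : Continuous a)
    (hd : ∀ t, 0 < t → HasDerivAt f (a t * f t) t) (h0 : f 0 ≠ 0) {t : ℝ} (ht : 0 ≤ t) :
    f t ≠ 0 := by
  obtain ⟨A, hA0, hA⟩ := exists_antiderivative ha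
  have hAc : Continuous A := continuous_iff_continuousAt.2 fun t => (hA t).continuousAt
  have h := eq_of_hasDerivAt_zero_Ioi (f := fun t => f t * Real.exp (-A t)) (a := 0) (t := t)
    (by fun_prop) (fun τ hτ => by
      have := (hd τ hτ).mul ((hA τ).fun_neg.exp)
      exact this.congr_deriv (by ring)) ht
  intro hft
  simp [hft, hA0] at h
  exact h0 h.symm

/-- Solutions of `y' = c y - s` with `c` bounded below and `s → 0` are unstable: there is one
initial value from which `y → 0`, and `y` diverges from every other one. -/
theorem exists_unstable_initial_value {c s : ℝ → ℝ} {c₀ T : ℝ} (hc : Continuous c)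
    (hs : Continuous s) (hc₀ : 0 < c₀) (hcT : ∀ t, T ≤ t → c₀ ≤ c t)
    (hs0 : Tendsto s atTop (𝓝 0)) :
    ∃ L, ∀ y : ℝ → ℝ, ContinuousOn y (Ici 0) →
      (∀ t, 0 < t → HasDerivAt y (c t * y t - s t) t) →
      (y 0 = L → Tendsto y atTop (𝓝 0)) ∧ (L < y 0 → Tendsto y atTop atTop) ∧
        (y 0 < L → Tendsto y atTop atBot) := by
  obtain ⟨A, hA0, hA⟩ := exists_antiderivative hc
  have hAc : Continuous A := continuous_iff_continuousAt.2 fun t => (hA t).continuousAt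
  -- Variation of constants: solutions are `exp A * (y 0 + B)`, so the limit of `B` decides their
  -- fate.
  obtain ⟨B, hB0, hB⟩ := exists_antiderivative (a := fun t => -s t * Real.exp (-A t)) (by fun_prop)
  have hBc : Continuous B := continuous_iff_continuousAt.2 fun t => (hB t).continuousAt
  have hE : ∀ t, HasDerivAt (fun t => Real.exp (-A t)) (-c t * Real.exp (-A t)) t := fun t =>
    (hA t).fun_neg.exp.congr_deriv (by ring)
  have hAtop : Tendsto A atTop atTop := by
    have hmono := monotoneOn_Ici_of_hasDerivAt_nonneg (a := T) (f := fun t => A t - c₀ * t)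
      (f' := fun t => c t - c₀ * 1) (by fun_prop)
      (fun t _ => (hA t).sub ((hasDerivAt_id t).const_mul c₀))
      (fun t ht => by linarith [hcT t ht.le])
    refine tendsto_atTop_mono' atTop ?_ (tendsto_atTop_add_const_right atTop (A T - c₀ * T)
      (tendsto_id.const_mul_atTop hc₀))
    filter_upwards [eventually_ge_atTop T] with t ht
    have := hmono self_mem_Ici ht ht
    simp only [id] at this ⊢
    linarith
  have hE0 : Tendsto (fun t => Real.exp (-A t)) atTop (𝓝 0) :=
    Real.tendsto_exp_neg_atTop_nhds_zero.comp hAtop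
  -- Once `|s| ≤ K c₀ ≤ K c`, the derivative `(-s - K c) exp (-A)` is nonpositive. With the mirror
  -- bound `hmono`, this traps `B` within `K exp (-A)` of its limit, with no integrability of `s`.
  have hanti : ∀ K T', T ≤ T' → 0 ≤ K → (∀ t, T' ≤ t → |s t| ≤ K * c₀) →
      AntitoneOn (fun t => B t + K * Real.exp (-A t)) (Ici T') := fun K T' hT' hK hsK =>
    antitoneOn_Ici_of_hasDerivAt_nonpos (by fun_prop)
      (fun t _ => (hB t).add ((hE t).const_mul K)) fun t ht => by
        have h1 : -s t - K * c t ≤ 0 := by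
          have := mul_le_mul_of_nonneg_left (hcT t (hT'.trans ht.le)) hK
          linarith [neg_abs_le (s t), hsK t ht.le]
        have := mul_nonpos_of_nonpos_of_nonneg h1 (Real.exp_pos (-A t)).le
        linarith
  have hmono : ∀ K T', T ≤ T' → 0 ≤ K → (∀ t, T' ≤ t → |s t| ≤ K * c₀) →
      MonotoneOn (fun t => B t - K * Real.exp (-A t)) (Ici T') := fun K T' hT' hK hsK =>
    monotoneOn_Ici_of_hasDerivAt_nonneg (by fun_prop)
      (fun t _ => (hB t).sub ((hE t).const_mul K)) fun t ht => by
        have h1 : 0 ≤ -s t + K * c t := by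
          have := mul_le_mul_of_nonneg_left (hcT t (hT'.trans ht.le)) hK
          linarith [le_abs_self (s t), hsK t ht.le]
        have := mul_nonneg h1 (Real.exp_pos (-A t)).le
        linarith
  have hsmall : ∀ K, 0 < K → ∃ T', T ≤ T' ∧ ∀ t, T' ≤ t → |s t| ≤ K * c₀ := fun K hK => by
    have habs : Tendsto (fun t => |s t|) atTop (𝓝 0) := by simpa using hs0.abs
    obtain ⟨T₁, hT₁⟩ := eventually_atTop.1
      (habs.eventually (gt_mem_nhds (show 0 < K * c₀ by positivity)))
    exact ⟨max T T₁, le_max_left _ _, fun t ht => (hT₁ t ((le_max_right _ _).trans ht)).le⟩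
  obtain ⟨l, hl⟩ : ∃ l, Tendsto B atTop (𝓝 l) := by
    obtain ⟨T₁, hT₁, hsT₁⟩ := hsmall 1 one_pos
    have ha := hanti 1 T₁ hT₁ zero_le_one hsT₁
    have hm := hmono 1 T₁ hT₁ zero_le_one hsT₁
    have ha' : Antitone fun t => B (max t T₁) + 1 * Real.exp (-A (max t T₁)) := fun a b hab =>
      ha (mem_Ici.2 (le_max_right _ _)) (mem_Ici.2 (le_max_right _ _)) (max_le_max_right T₁ hab)
    have hlim := tendsto_atTop_ciInf ha' ⟨B T₁ - 1 * Real.exp (-A T₁), by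
      rintro _ ⟨t, rfl⟩
      have h1 := hm self_mem_Ici (mem_Ici.2 (le_max_right t T₁)) (le_max_right t T₁)
      have h2 := Real.exp_pos (-A (max t T₁))
      dsimp only at h1 ⊢
      linarith⟩
    refine ⟨_, ((hlim.congr' ?_).sub hE0).congr fun t => add_sub_cancel_right _ _⟩
    filter_upwards [eventually_ge_atTop T₁] with t ht
    rw [max_eq_left ht, one_mul]
  refine ⟨-l, fun y hyc hyd => ?_⟩
  have hy : ∀ t, 0 ≤ t → y t = Real.exp (A t) * (y 0 + B t) := fun t ht => by
    have h1 := eq_of_hasDerivAt_zero_Ioi (a := 0) (f := fun t => y t * Real.exp (-A t) - B t)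
      ((hyc.mul (by fun_prop)).sub (by fun_prop))
      (fun t ht => (((hyd t ht).mul (hE t)).sub (hB t)).congr_deriv (by ring)) ht
    simp only [hA0, hB0, neg_zero, Real.exp_zero, mul_one, sub_zero] at h1
    rw [← h1, sub_add_cancel, mul_comm, mul_assoc, ← Real.exp_add, neg_add_cancel, Real.exp_zero,
      mul_one]
  have hyev : y =ᶠ[atTop] fun t => Real.exp (A t) * (y 0 + B t) := by
    filter_upwards [eventually_ge_atTop 0] with t ht using hy t ht
  have hexp : Tendsto (fun t => Real.exp (A t)) atTop atTop := Real.tendsto_exp_atTop.comp hAtop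
  refine ⟨fun h0 => ?_, fun h0 => ?_, fun h0 => ?_⟩
  · rw [Metric.tendsto_atTop]
    intro ε hε
    obtain ⟨T₁, hT₁, hsT₁⟩ := hsmall (ε / 2) (half_pos hε)
    have ha := hanti (ε / 2) T₁ hT₁ (half_pos hε).le hsT₁
    have hm := hmono (ε / 2) T₁ hT₁ (half_pos hε).le hsT₁
    refine ⟨max T₁ 0, fun t ht => ?_⟩
    have htT : T₁ ≤ t := (le_max_left _ _).trans ht
    have h1 : l ≤ B t + ε / 2 * Real.exp (-A t) := by
      refine le_of_tendsto (f := fun t => B t + ε / 2 * Real.exp (-A t)) (x := atTop)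
        (by simpa using hl.add (hE0.const_mul (ε / 2))) ?_
      filter_upwards [eventually_ge_atTop t] with τ hτ
      exact ha htT (mem_Ici.2 (htT.trans hτ)) hτ
    have h2 : B t - ε / 2 * Real.exp (-A t) ≤ l := by
      refine ge_of_tendsto (f := fun t => B t - ε / 2 * Real.exp (-A t)) (x := atTop)
        (by simpa using hl.sub (hE0.const_mul (ε / 2))) ?_
      filter_upwards [eventually_ge_atTop t] with τ hτ
      exact hm htT (mem_Ici.2 (htT.trans hτ)) hτ
    have h3 : |B t - l| ≤ ε / 2 * Real.exp (-A t) := abs_le.2 ⟨by linarith, by linarith⟩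
    -- The factor `exp A` in `y` exactly cancels the `exp (-A)` in the trap around `l`.
    have h4 := mul_le_mul_of_nonneg_left h3 (Real.exp_pos (A t)).le
    rw [Real.dist_eq, sub_zero, hy t ((le_max_right _ _).trans ht), h0, abs_mul, Real.abs_exp,
      neg_add_eq_sub]
    rw [mul_left_comm, ← Real.exp_add, add_neg_cancel, Real.exp_zero, mul_one] at h4
    linarith
  · exact (hexp.atTop_mul_pos (show 0 < y 0 + l by linarith) (hl.const_add _)).congr' hyev.symm
  · exact (hexp.atTop_mul_neg (show y 0 + l < 0 by linarith) (hl.const_add _)).congr' hyev.symm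

/-- A nonnegative function satisfying `F' ≤ -k F + G` with `G → 0` tends to `0`. -/
theorem tendsto_zero_of_hasDerivAt_le {F F' G : ℝ → ℝ} {k T : ℝ} (hk : 0 < k)
    (hc : Continuous F) (hd : ∀ t, T < t → HasDerivAt F (F' t) t) (hpos : ∀ t, 0 ≤ F t)
    (hle : ∀ t, T < t → F' t ≤ -k * F t + G t) (hG : Tendsto G atTop (𝓝 0)) :
    Tendsto F atTop (𝓝 0) := by
  rw [Metric.tendsto_atTop]
  intro ε hε
  have hκ : 0 < k * (ε / 2) := by positivity
  obtain ⟨T₁, hT₁⟩ := eventually_atTop.1 (hG.eventually (gt_mem_nhds hκ))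
  set T₂ := max T T₁ with hT₂
  -- Past `T₂`, `G < k ε / 2`, hence `(F - ε / 2)' ≤ -k (F - ε / 2)`.
  have hanti := antitoneOn_Ici_of_hasDerivAt_nonpos (a := T₂)
    (f := fun t => (F t - ε / 2) * Real.exp (k * t))
    (f' := fun t => F' t * Real.exp (k * t) + (F t - ε / 2) * (Real.exp (k * t) * k))
    (by fun_prop)
    (fun t ht => by
      have h1 := (hd t ((le_max_left _ _).trans_lt ht)).sub_const (ε / 2)
      have h2 : HasDerivAt (fun t => Real.exp (k * t)) (Real.exp (k * t) * k) t := by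
        simpa using ((hasDerivAt_id t).const_mul k).exp
      exact h1.mul h2)
    (fun t ht => by
      have h1 := hle t ((le_max_left _ _).trans_lt ht)
      have h2 := hT₁ t ((le_max_right _ _).trans ht.le)
      have h3 : F' t + (F t - ε / 2) * k ≤ 0 := by nlinarith
      have h4 := mul_nonpos_of_nonpos_of_nonneg h3 (Real.exp_pos (k * t)).le
      nlinarith)
  have hlim : Tendsto (fun t => (F T₂ - ε / 2) * Real.exp (k * T₂) * Real.exp (-(k * t))) atTop
      (𝓝 0) := by
    have : Tendsto (fun t : ℝ => Real.exp (-(k * t))) atTop (𝓝 0) :=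
      Real.tendsto_exp_neg_atTop_nhds_zero.comp (tendsto_id.const_mul_atTop hk)
    simpa using this.const_mul ((F T₂ - ε / 2) * Real.exp (k * T₂))
  obtain ⟨T₃, hT₃⟩ := eventually_atTop.1 (hlim.eventually (gt_mem_nhds (half_pos hε)))
  refine ⟨max T₂ T₃, fun t ht => ?_⟩
  have h1 := hanti self_mem_Ici ((le_max_left _ _).trans ht) ((le_max_left _ _).trans ht)
  have h2 := hT₃ t ((le_max_right _ _).trans ht)
  have h3 : F t - ε / 2 ≤ (F T₂ - ε / 2) * Real.exp (k * T₂) * Real.exp (-(k * t)) := by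
    have h4 := mul_le_mul_of_nonneg_right h1 (Real.exp_pos (-(k * t))).le
    rwa [mul_assoc, ← Real.exp_add, add_neg_cancel, Real.exp_zero, mul_one] at h4
  rw [Real.dist_eq, sub_zero, abs_of_nonneg (hpos t)]
  linarith

/-- Barbalat's lemma: a nonnegative derivative of a bounded function that is itself
differentiable with bounded derivative tends to `0`. -/
theorem tendsto_zero_of_hasDerivAt_of_bounded {N S S' : ℝ → ℝ} {K M : ℝ} (hNc : Continuous N)
    (hN : ∀ t, 0 < t → HasDerivAt N (S t) t) (hS : ∀ t, 0 < t → HasDerivAt S (S' t) t)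
    (hSpos : ∀ t, 0 ≤ S t) (hK : ∀ t, 0 < t → |S' t| ≤ K) (hM : ∀ t, N t ≤ M) :
    Tendsto S atTop (𝓝 0) := by
  have hmono := monotoneOn_Ici_of_hasDerivAt_nonneg (a := 0) hNc.continuousOn hN fun t _ => hSpos t
  have hmono' : Monotone fun t => N (max t 0) := fun a b hab =>
    hmono (mem_Ici.2 (le_max_right _ _)) (mem_Ici.2 (le_max_right _ _)) (max_le_max_right 0 hab)
  obtain ⟨l, hl⟩ : ∃ l, Tendsto (fun t => N (max t 0)) atTop (𝓝 l) :=
    ⟨_, tendsto_atTop_ciSup hmono' ⟨M, by rintro _ ⟨t, rfl⟩; exact hM _⟩⟩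
  have hlN : Tendsto N atTop (𝓝 l) := hl.congr' <| by
    filter_upwards [eventually_ge_atTop (0 : ℝ)] with t ht
    rw [max_eq_left ht]
  have hK0 : 0 ≤ K := (abs_nonneg _).trans (hK 1 one_pos)
  rw [Metric.tendsto_atTop]
  intro ε hε
  -- Over a time `h` the function `S` varies by at most `ε / 2`, while its value at some point of
  -- `(t, t + h)` is the slope of `N`, which is eventually below `ε / 2`.
  obtain ⟨h, hh, hKh⟩ : ∃ h : ℝ, 0 < h ∧ K * h ≤ ε / 2 := by
    refine ⟨ε / (2 * (K + 1)), by positivity, ?_⟩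
    rw [mul_div_assoc', div_le_iff₀ (by positivity)]
    nlinarith
  have hdiff : Tendsto (fun t => N (t + h) - N t) atTop (𝓝 0) := by
    simpa using (hlN.comp (tendsto_atTop_add_const_right atTop h tendsto_id)).sub hlN
  obtain ⟨T, hT⟩ := eventually_atTop.1
    (hdiff.eventually (gt_mem_nhds (show (0 : ℝ) < h * (ε / 2) by positivity)))
  refine ⟨max T 1, fun t ht => ?_⟩
  have ht0 : 0 < t := one_pos.trans_le ((le_max_right _ _).trans ht)
  obtain ⟨ξ, hξ, hξ'⟩ := exists_hasDerivAt_eq_slope N S (show t < t + h by linarith)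
    hNc.continuousOn (fun x hx => hN x (ht0.trans hx.1))
  have h1 := hT t ((le_max_left _ _).trans ht)
  have h2 : S ξ < ε / 2 := by
    rw [hξ', add_sub_cancel_left, div_lt_iff₀ hh]
    linarith
  have h3 : |S ξ - S t| ≤ K * |ξ - t| := by
    have := (convex_Ioi (0 : ℝ)).norm_image_sub_le_of_norm_hasDerivWithin_le (f := S) (f' := S')
      (C := K) (fun x hx => (hS x hx).hasDerivWithinAt) (fun x hx => hK x hx)
      (show t ∈ Ioi 0 from ht0) (show ξ ∈ Ioi 0 from ht0.trans hξ.1)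
    simpa using this
  have h4 : K * |ξ - t| ≤ K * h := by
    apply mul_le_mul_of_nonneg_left _ hK0
    rw [abs_of_nonneg (by linarith [hξ.1])]
    linarith [hξ.2]
  rw [Real.dist_eq, sub_zero, abs_of_nonneg (hSpos t)]
  linarith [neg_abs_le (S ξ - S t)]

/-- A function whose derivative is positive whenever it equals `c` cannot cross `c` downwards. -/
theorem le_of_hasDerivAt_pos_of_eq {f f' : ℝ → ℝ} {c T : ℝ} (hf : Continuous f)
    (hd : ∀ t, T ≤ t → HasDerivAt f (f' t) t) (hT : c ≤ f T)
    (hpos : ∀ t, T ≤ t → f t = c → 0 < f' t) {t : ℝ} (ht : T ≤ t) : c ≤ f t := by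
  have := image_le_of_deriv_right_lt_deriv_boundary (f := fun t => -f t) (f' := fun t => -f' t)
    (a := T) (b := t) (B := fun _ => -c) (B' := fun _ => 0) hf.neg.continuousOn
    (fun x hx => (hd x hx.1).neg.hasDerivWithinAt) (neg_le_neg hT)
    (fun x => hasDerivAt_const x _)
    (fun x hx h => neg_lt_zero.2 (hpos x hx.1 (neg_injective h))) (right_mem_Icc.2 ht)
  exact neg_le_neg_iff.1 this

/-! ### Integrals against probability measures -/

section Integral

variable {Ω : Type*} [MeasurableSpace Ω] {μ : Measure Ω} [IsProbabilityMeasure μ]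

theorem integrable_of_measurable_of_abs_le {f : Ω → ℝ} {K : ℝ} (hf : Measurable f)
    (hK : ∀ p, |f p| ≤ K) : Integrable f μ :=
  .of_bound hf.aestronglyMeasurable K (ae_of_all _ hK)

theorem abs_integral_le_of_abs_le {f : Ω → ℝ} {K : ℝ} (hK : ∀ p, |f p| ≤ K) :
    |∫ p, f p ∂μ| ≤ K := by
  simpa using norm_integral_le_of_norm_le_const (μ := μ) (f := f) (ae_of_all _ hK)

/-- The variance is nonnegative. -/
theorem sq_integral_le_integral_sq {f : Ω → ℝ} {K : ℝ} (hf : Measurable f)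
    (hK : ∀ p, |f p| ≤ K) : (∫ p, f p ∂μ) ^ 2 ≤ ∫ p, f p ^ 2 ∂μ := by
  have hfi : Integrable f μ := integrable_of_measurable_of_abs_le hf hK
  have hfi2 : Integrable (fun p => f p ^ 2) μ :=
    integrable_of_measurable_of_abs_le (K := K ^ 2) (hf.pow_const 2) fun p => by
      rw [abs_pow]
      exact pow_le_pow_left₀ (abs_nonneg _) (hK p) 2
  set m := ∫ p, f p ∂μ with hm
  have h0 : 0 ≤ ∫ p, (f p - m) ^ 2 ∂μ := integral_nonneg fun p => sq_nonneg _
  have h1 : ∫ p, (f p - m) ^ 2 ∂μ = ∫ p, ((f p ^ 2 - 2 * m * f p) + m ^ 2) ∂μ :=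
    integral_congr_ae (ae_of_all _ fun p => by ring)
  have h2 : Integrable (fun p => f p ^ 2 - 2 * m * f p) μ := hfi2.sub (hfi.const_mul _)
  rw [h1, integral_add h2 (integrable_const _),
    integral_sub hfi2 (hfi.const_mul _), integral_const_mul, ← hm] at h0
  simp at h0
  nlinarith

theorem hasDerivAt_integral_of_abs_le {f f' : Ω → ℝ → ℝ} {K M t : ℝ} (ht : 0 < t)
    (hm : ∀ t, Measurable fun p => f p t) (hm' : ∀ t, Measurable fun p => f' p t)
    (hM : ∀ p t, |f p t| ≤ M) (hK : ∀ p t, |f' p t| ≤ K)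
    (hd : ∀ p t, 0 < t → HasDerivAt (f p) (f' p t) t) :
    HasDerivAt (fun t => ∫ p, f p t ∂μ) (∫ p, f' p t ∂μ) t :=
  (hasDerivAt_integral_of_dominated_loc_of_deriv_le (F := fun t p => f p t)
    (F' := fun t p => f' p t) (bound := fun _ => K) (Ioi_mem_nhds ht)
    (Eventually.of_forall fun t => (hm t).aestronglyMeasurable)
    (integrable_of_measurable_of_abs_le (hm t) (hM · t))
    (hm' t).aestronglyMeasurable (ae_of_all _ fun p x _ => hK p x) (integrable_const _)
    (ae_of_all _ fun p x hx => hd p x hx)).2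

theorem continuous_integral_of_abs_le {f : Ω → ℝ → ℝ} {M : ℝ}
    (hm : ∀ t, Measurable fun p => f p t) (hM : ∀ p t, |f p t| ≤ M)
    (hc : ∀ p, Continuous (f p)) : Continuous fun t => ∫ p, f p t ∂μ :=
  continuous_of_dominated (F := fun t p => f p t) (bound := fun _ => M)
    (fun t => (hm t).aestronglyMeasurable) (fun t => ae_of_all _ fun p => hM p t)
    (integrable_const _) (ae_of_all _ hc)

end Integral

/-! ### Phases driven by their mean field -/

section MeanField

variable {Ω : Type*}

/-- The component `R sin (γ - φ)` of the field `(X, Y) = R (cos φ, sin φ)`. -/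
noncomputable def fieldSin (γ : Ω → ℝ → ℝ) (X Y : ℝ → ℝ) (p : Ω) (t : ℝ) : ℝ :=
  Real.sin (γ p t) * X t - Real.cos (γ p t) * Y t

/-- The component `R cos (γ - φ)` of the field `(X, Y) = R (cos φ, sin φ)`. -/
noncomputable def fieldCos (γ : Ω → ℝ → ℝ) (X Y : ℝ → ℝ) (p : Ω) (t : ℝ) : ℝ :=
  Real.cos (γ p t) * X t + Real.sin (γ p t) * Y t

theorem abs_sin_mul_sub_cos_mul_le (x a b : ℝ) :
    |Real.sin x * a - Real.cos x * b| ≤ |a| + |b| := by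
  refine (abs_sub _ _).trans (add_le_add ?_ ?_) <;> rw [abs_mul]
  · exact mul_le_of_le_one_left (abs_nonneg _) (Real.abs_sin_le_one _)
  · exact mul_le_of_le_one_left (abs_nonneg _) (Real.abs_cos_le_one _)

theorem abs_cos_mul_add_sin_mul_le (x a b : ℝ) :
    |Real.cos x * a + Real.sin x * b| ≤ |a| + |b| := by
  refine (abs_add_le _ _).trans (add_le_add ?_ ?_) <;> rw [abs_mul]
  · exact mul_le_of_le_one_left (abs_nonneg _) (Real.abs_cos_le_one _)
  · exact mul_le_of_le_one_left (abs_nonneg _) (Real.abs_sin_le_one _)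

theorem fieldSin_sq_add_fieldCos_sq (γ : Ω → ℝ → ℝ) (X Y : ℝ → ℝ) (p : Ω) (t : ℝ) :
    fieldSin γ X Y p t ^ 2 + fieldCos γ X Y p t ^ 2 = X t ^ 2 + Y t ^ 2 := by
  have := Real.sin_sq_add_cos_sq (γ p t)
  simp only [fieldSin, fieldCos]
  linear_combination (X t ^ 2 + Y t ^ 2) * this

variable [MeasurableSpace Ω]

/-- The time derivative of the mean of `cos γ`. -/
noncomputable def meanCosDeriv (μ : Measure Ω) (γ : Ω → ℝ → ℝ) (X Y : ℝ → ℝ) (t : ℝ) : ℝ :=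
  ∫ p, Real.sin (γ p t) * fieldSin γ X Y p t ∂μ

/-- The time derivative of the mean of `sin γ`. -/
noncomputable def meanSinDeriv (μ : Measure Ω) (γ : Ω → ℝ → ℝ) (X Y : ℝ → ℝ) (t : ℝ) : ℝ :=
  ∫ p, -Real.cos (γ p t) * fieldSin γ X Y p t ∂μ

/-- A family of phases `γ p` that solves `γ' = -R sin (γ - φ)` for `t > 0`, where
`R (cos φ, sin φ) = (X, Y)` is the mean of `(cos γ, sin γ)`. -/
structure IsMeanFieldFlow (μ : Measure Ω) (γ : Ω → ℝ → ℝ) (X Y : ℝ → ℝ) : Prop where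
  continuous : ∀ p, Continuous (γ p)
  hasDerivAt : ∀ p t, 0 < t → HasDerivAt (γ p) (-fieldSin γ X Y p t) t
  measurable_sin : ∀ t, Measurable fun p => Real.sin (γ p t)
  measurable_cos : ∀ t, Measurable fun p => Real.cos (γ p t)
  X_eq : ∀ t, X t = ∫ p, Real.cos (γ p t) ∂μ
  Y_eq : ∀ t, Y t = ∫ p, Real.sin (γ p t) ∂μ

namespace IsMeanFieldFlow

variable {μ : Measure Ω} {γ : Ω → ℝ → ℝ} {X Y : ℝ → ℝ}

theorem measurable_fieldSin (h : IsMeanFieldFlow μ γ X Y) (t : ℝ) :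
    Measurable fun p => fieldSin γ X Y p t :=
  ((h.measurable_sin t).mul_const _).sub ((h.measurable_cos t).mul_const _)

theorem measurable_fieldCos (h : IsMeanFieldFlow μ γ X Y) (t : ℝ) :
    Measurable fun p => fieldCos γ X Y p t :=
  ((h.measurable_cos t).mul_const _).add ((h.measurable_sin t).mul_const _)

theorem measurable_sin_mul_fieldSin (h : IsMeanFieldFlow μ γ X Y) (t : ℝ) :
    Measurable fun p => Real.sin (γ p t) * fieldSin γ X Y p t :=
  (h.measurable_sin t).mul (h.measurable_fieldSin t)

theorem measurable_neg_cos_mul_fieldSin (h : IsMeanFieldFlow μ γ X Y) (t : ℝ) :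
    Measurable fun p => -Real.cos (γ p t) * fieldSin γ X Y p t :=
  (h.measurable_cos t).neg.mul (h.measurable_fieldSin t)

variable [IsProbabilityMeasure μ]

theorem integrable_cos (h : IsMeanFieldFlow μ γ X Y) (t : ℝ) :
    Integrable (fun p => Real.cos (γ p t)) μ :=
  integrable_of_measurable_of_abs_le (h.measurable_cos t) fun _ => Real.abs_cos_le_one _

theorem integrable_sin (h : IsMeanFieldFlow μ γ X Y) (t : ℝ) :
    Integrable (fun p => Real.sin (γ p t)) μ :=
  integrable_of_measurable_of_abs_le (h.measurable_sin t) fun _ => Real.abs_sin_le_one _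

theorem abs_X_le (h : IsMeanFieldFlow μ γ X Y) (t : ℝ) : |X t| ≤ 1 := by
  rw [h.X_eq]
  exact abs_integral_le_of_abs_le fun _ => Real.abs_cos_le_one _

theorem abs_Y_le (h : IsMeanFieldFlow μ γ X Y) (t : ℝ) : |Y t| ≤ 1 := by
  rw [h.Y_eq]
  exact abs_integral_le_of_abs_le fun _ => Real.abs_sin_le_one _

theorem abs_fieldSin_le (h : IsMeanFieldFlow μ γ X Y) (p : Ω) (t : ℝ) :
    |fieldSin γ X Y p t| ≤ 2 :=
  (abs_sin_mul_sub_cos_mul_le _ _ _).trans (by linarith [h.abs_X_le t, h.abs_Y_le t])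

theorem abs_fieldCos_le (h : IsMeanFieldFlow μ γ X Y) (p : Ω) (t : ℝ) :
    |fieldCos γ X Y p t| ≤ 2 :=
  (abs_cos_mul_add_sin_mul_le _ _ _).trans (by linarith [h.abs_X_le t, h.abs_Y_le t])

theorem abs_sin_mul_fieldSin_le (h : IsMeanFieldFlow μ γ X Y) (p : Ω) (t : ℝ) :
    |Real.sin (γ p t) * fieldSin γ X Y p t| ≤ 2 := by
  rw [abs_mul]
  nlinarith [Real.abs_sin_le_one (γ p t), h.abs_fieldSin_le p t, abs_nonneg (Real.sin (γ p t)),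
    abs_nonneg (fieldSin γ X Y p t)]

theorem abs_neg_cos_mul_fieldSin_le (h : IsMeanFieldFlow μ γ X Y) (p : Ω) (t : ℝ) :
    |-Real.cos (γ p t) * fieldSin γ X Y p t| ≤ 2 := by
  rw [abs_mul, abs_neg]
  nlinarith [Real.abs_cos_le_one (γ p t), h.abs_fieldSin_le p t, abs_nonneg (Real.cos (γ p t)),
    abs_nonneg (fieldSin γ X Y p t)]

theorem hasDerivAt_X (h : IsMeanFieldFlow μ γ X Y) {t : ℝ} (ht : 0 < t) :
    HasDerivAt X (meanCosDeriv μ γ X Y t) t := by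
  have key : HasDerivAt (fun t => ∫ p, Real.cos (γ p t) ∂μ) (meanCosDeriv μ γ X Y t) t :=
    hasDerivAt_integral_of_abs_le ht h.measurable_cos
      h.measurable_sin_mul_fieldSin (fun p t => Real.abs_cos_le_one _) h.abs_sin_mul_fieldSin_le
      fun p t ht => (h.hasDerivAt p t ht).cos.congr_deriv (by ring)
  exact key.congr_of_eventuallyEq (Eventually.of_forall h.X_eq)

theorem hasDerivAt_Y (h : IsMeanFieldFlow μ γ X Y) {t : ℝ} (ht : 0 < t) :
    HasDerivAt Y (meanSinDeriv μ γ X Y t) t := by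
  have key : HasDerivAt (fun t => ∫ p, Real.sin (γ p t) ∂μ) (meanSinDeriv μ γ X Y t) t :=
    hasDerivAt_integral_of_abs_le ht h.measurable_sin
      h.measurable_neg_cos_mul_fieldSin (fun p t => Real.abs_sin_le_one _)
      h.abs_neg_cos_mul_fieldSin_le
      fun p t ht => (h.hasDerivAt p t ht).sin.congr_deriv (by ring)
  exact key.congr_of_eventuallyEq (Eventually.of_forall h.Y_eq)

theorem continuous_X (h : IsMeanFieldFlow μ γ X Y) : Continuous X := by
  rw [funext h.X_eq]
  exact continuous_integral_of_abs_le h.measurable_cos (fun p t => Real.abs_cos_le_one _)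
    fun p => Real.continuous_cos.comp (h.continuous p)

theorem continuous_Y (h : IsMeanFieldFlow μ γ X Y) : Continuous Y := by
  rw [funext h.Y_eq]
  exact continuous_integral_of_abs_le h.measurable_sin (fun p t => Real.abs_sin_le_one _)
    fun p => Real.continuous_sin.comp (h.continuous p)

theorem continuous_fieldSin (h : IsMeanFieldFlow μ γ X Y) (p : Ω) :
    Continuous (fieldSin γ X Y p) :=
  ((Real.continuous_sin.comp (h.continuous p)).mul h.continuous_X).sub
    ((Real.continuous_cos.comp (h.continuous p)).mul h.continuous_Y)

theorem continuous_fieldCos (h : IsMeanFieldFlow μ γ X Y) (p : Ω) :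
    Continuous (fieldCos γ X Y p) :=
  ((Real.continuous_cos.comp (h.continuous p)).mul h.continuous_X).add
    ((Real.continuous_sin.comp (h.continuous p)).mul h.continuous_Y)

theorem hasDerivAt_fieldSin (h : IsMeanFieldFlow μ γ X Y) (p : Ω) {t : ℝ} (ht : 0 < t) :
    HasDerivAt (fieldSin γ X Y p) (-fieldCos γ X Y p t * fieldSin γ X Y p t +
      (Real.sin (γ p t) * meanCosDeriv μ γ X Y t - Real.cos (γ p t) * meanSinDeriv μ γ X Y t)) t :=
  (((h.hasDerivAt p t ht).sin.mul (h.hasDerivAt_X ht)).sub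
    ((h.hasDerivAt p t ht).cos.mul (h.hasDerivAt_Y ht))).congr_deriv (by
      simp only [fieldCos]; ring)

/-- The square comes from the particle turning towards the field, the bracket from the motion of the
field itself, which fades with time. -/
theorem hasDerivAt_fieldCos (h : IsMeanFieldFlow μ γ X Y) (p : Ω) {t : ℝ} (ht : 0 < t) :
    HasDerivAt (fieldCos γ X Y p) (fieldSin γ X Y p t ^ 2 +
      (Real.cos (γ p t) * meanCosDeriv μ γ X Y t + Real.sin (γ p t) * meanSinDeriv μ γ X Y t)) t :=
  (((h.hasDerivAt p t ht).cos.mul (h.hasDerivAt_X ht)).add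
    ((h.hasDerivAt p t ht).sin.mul (h.hasDerivAt_Y ht))).congr_deriv (by
      simp only [fieldSin]; ring)

/-- The interaction is odd: averaging gives `Y X - X Y`. This is the conservation of the mean phase.
-/
theorem integral_fieldSin (h : IsMeanFieldFlow μ γ X Y) (t : ℝ) :
    ∫ p, fieldSin γ X Y p t ∂μ = 0 := by
  simp only [fieldSin]
  rw [integral_sub ((h.integrable_sin t).mul_const _) ((h.integrable_cos t).mul_const _),
    integral_mul_const, integral_mul_const, ← h.X_eq, ← h.Y_eq]
  ring

theorem integral_fieldCos (h : IsMeanFieldFlow μ γ X Y) (t : ℝ) :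
    ∫ p, fieldCos γ X Y p t ∂μ = X t ^ 2 + Y t ^ 2 := by
  simp only [fieldCos]
  rw [integral_add ((h.integrable_cos t).mul_const _) ((h.integrable_sin t).mul_const _),
    integral_mul_const, integral_mul_const, ← h.X_eq, ← h.Y_eq]
  ring

theorem integrable_fieldCos (h : IsMeanFieldFlow μ γ X Y) (t : ℝ) :
    Integrable (fun p => fieldCos γ X Y p t) μ :=
  integrable_of_measurable_of_abs_le (h.measurable_fieldCos t) (h.abs_fieldCos_le · t)

theorem integrable_fieldSin (h : IsMeanFieldFlow μ γ X Y) (t : ℝ) :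
    Integrable (fun p => fieldSin γ X Y p t) μ :=
  integrable_of_measurable_of_abs_le (h.measurable_fieldSin t) (h.abs_fieldSin_le · t)

theorem fieldSin_sq_le (h : IsMeanFieldFlow μ γ X Y) (p : Ω) (t : ℝ) :
    |fieldSin γ X Y p t ^ 2| ≤ 4 := by
  rw [abs_pow]
  nlinarith [h.abs_fieldSin_le p t, abs_nonneg (fieldSin γ X Y p t)]

theorem integrable_fieldSin_sq (h : IsMeanFieldFlow μ γ X Y) (t : ℝ) :
    Integrable (fun p => fieldSin γ X Y p t ^ 2) μ :=
  integrable_of_measurable_of_abs_le ((h.measurable_fieldSin t).pow_const 2) (h.fieldSin_sq_le · t)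

/-- Contracting the velocity of the mean field with `(X, Y)` rebuilds a second factor `fieldSin`;
the resulting square makes `R²` a Lyapunov function. -/
theorem hasDerivAt_normSq (h : IsMeanFieldFlow μ γ X Y) {t : ℝ} (ht : 0 < t) :
    HasDerivAt (fun t => X t ^ 2 + Y t ^ 2) (2 * ∫ p, fieldSin γ X Y p t ^ 2 ∂μ) t := by
  refine (((h.hasDerivAt_X ht).fun_pow 2).add ((h.hasDerivAt_Y ht).fun_pow 2)).congr_deriv ?_
  have h1 : ∫ p, fieldSin γ X Y p t ^ 2 ∂μ = ∫ p, (Real.sin (γ p t) * fieldSin γ X Y p t * X t +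
      -Real.cos (γ p t) * fieldSin γ X Y p t * Y t) ∂μ :=
    integral_congr_ae (ae_of_all _ fun p => by simp only [fieldSin]; ring)
  rw [h1, integral_add, integral_mul_const, integral_mul_const]
  · simp only [meanCosDeriv, meanSinDeriv]
    push_cast
    ring
  · exact (integrable_of_measurable_of_abs_le (h.measurable_sin_mul_fieldSin t)
      (h.abs_sin_mul_fieldSin_le · t)).mul_const _
  · exact (integrable_of_measurable_of_abs_le (h.measurable_neg_cos_mul_fieldSin t)
      (h.abs_neg_cos_mul_fieldSin_le · t)).mul_const _

theorem continuous_normSq (h : IsMeanFieldFlow μ γ X Y) :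
    Continuous fun t => X t ^ 2 + Y t ^ 2 :=
  (h.continuous_X.pow 2).add (h.continuous_Y.pow 2)

theorem integral_fieldSin_sq_nonneg (μ : Measure Ω) (γ : Ω → ℝ → ℝ) (X Y : ℝ → ℝ) (t : ℝ) :
    0 ≤ ∫ p, fieldSin γ X Y p t ^ 2 ∂μ :=
  integral_nonneg fun _ => sq_nonneg _

theorem monotoneOn_normSq (h : IsMeanFieldFlow μ γ X Y) :
    MonotoneOn (fun t => X t ^ 2 + Y t ^ 2) (Ici 0) :=
  monotoneOn_Ici_of_hasDerivAt_nonneg h.continuous_normSq.continuousOn (fun _ => h.hasDerivAt_normSq)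
    fun t _ => mul_nonneg zero_le_two (integral_fieldSin_sq_nonneg μ γ X Y t)

theorem integral_fieldSin_sq_le_normSq (h : IsMeanFieldFlow μ γ X Y) (t : ℝ) :
    ∫ p, fieldSin γ X Y p t ^ 2 ∂μ ≤ X t ^ 2 + Y t ^ 2 := by
  have : ∫ p, fieldSin γ X Y p t ^ 2 ∂μ ≤ ∫ _, (X t ^ 2 + Y t ^ 2) ∂μ :=
    integral_mono (h.integrable_fieldSin_sq t) (integrable_const _) fun p => by
      have := fieldSin_sq_add_fieldCos_sq γ X Y p t
      dsimp only
      nlinarith [sq_nonneg (fieldCos γ X Y p t)]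
  simpa using this

/-- The mean field either vanishes identically or never vanishes. -/
theorem normSq_zero_pos (h : IsMeanFieldFlow μ γ X Y) {t : ℝ} (ht : 0 ≤ t)
    (hpos : 0 < X t ^ 2 + Y t ^ 2) : 0 < X 0 ^ 2 + Y 0 ^ 2 := by
  -- Backward Grönwall: `(R²)' ≤ 2 R²`, so `R²` cannot start at zero and become positive.
  have hanti := antitoneOn_Ici_of_hasDerivAt_nonpos (a := 0)
    (f := fun t => (X t ^ 2 + Y t ^ 2) * Real.exp (-(2 * t)))
    (f' := fun t => (2 * ∫ p, fieldSin γ X Y p t ^ 2 ∂μ) * Real.exp (-(2 * t)) +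
      (X t ^ 2 + Y t ^ 2) * (Real.exp (-(2 * t)) * -(2 * 1)))
    (h.continuous_normSq.mul (by fun_prop)).continuousOn
    (fun t ht => (h.hasDerivAt_normSq ht).mul ((hasDerivAt_id t).const_mul 2).fun_neg.exp)
    (fun t _ => by
      have h1 := h.integral_fieldSin_sq_le_normSq t
      have h2 := mul_le_mul_of_nonneg_right h1 (Real.exp_pos (-(2 * t))).le
      linarith)
  have h1 := hanti self_mem_Ici ht ht
  simp only [mul_zero, neg_zero, Real.exp_zero, mul_one] at h1
  exact (mul_pos hpos (Real.exp_pos _)).trans_le h1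

theorem abs_meanCosDeriv_le (h : IsMeanFieldFlow μ γ X Y) (t : ℝ) :
    |meanCosDeriv μ γ X Y t| ≤ 2 :=
  abs_integral_le_of_abs_le (h.abs_sin_mul_fieldSin_le · t)

theorem abs_meanSinDeriv_le (h : IsMeanFieldFlow μ γ X Y) (t : ℝ) :
    |meanSinDeriv μ γ X Y t| ≤ 2 :=
  abs_integral_le_of_abs_le (h.abs_neg_cos_mul_fieldSin_le · t)

theorem sq_meanCosDeriv_le (h : IsMeanFieldFlow μ γ X Y) (t : ℝ) :
    meanCosDeriv μ γ X Y t ^ 2 ≤ ∫ p, fieldSin γ X Y p t ^ 2 ∂μ := by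
  refine (sq_integral_le_integral_sq (h.measurable_sin_mul_fieldSin t)
    (h.abs_sin_mul_fieldSin_le · t)).trans (integral_mono_of_nonneg
      (ae_of_all _ fun _ => sq_nonneg _) (h.integrable_fieldSin_sq t) (ae_of_all _ fun p => ?_))
  simp only [mul_pow]
  exact mul_le_of_le_one_left (sq_nonneg _) (Real.sin_sq_le_one _)

theorem sq_meanSinDeriv_le (h : IsMeanFieldFlow μ γ X Y) (t : ℝ) :
    meanSinDeriv μ γ X Y t ^ 2 ≤ ∫ p, fieldSin γ X Y p t ^ 2 ∂μ := by
  refine (sq_integral_le_integral_sq (h.measurable_neg_cos_mul_fieldSin t)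
    (h.abs_neg_cos_mul_fieldSin_le · t)).trans (integral_mono_of_nonneg
      (ae_of_all _ fun _ => sq_nonneg _) (h.integrable_fieldSin_sq t) (ae_of_all _ fun p => ?_))
  simp only [mul_pow, neg_sq]
  exact mul_le_of_le_one_left (sq_nonneg _) (Real.cos_sq_le_one _)

/-- Barbalat's lemma for `N = X² + Y²`: it is bounded, and its second derivative is bounded because
all fields and velocities are. -/
theorem tendsto_integral_fieldSin_sq (h : IsMeanFieldFlow μ γ X Y) :
    Tendsto (fun t => ∫ p, fieldSin γ X Y p t ^ 2 ∂μ) atTop (𝓝 0) := by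
  let s' : Ω → ℝ → ℝ := fun p t => -fieldCos γ X Y p t * fieldSin γ X Y p t +
    (Real.sin (γ p t) * meanCosDeriv μ γ X Y t - Real.cos (γ p t) * meanSinDeriv μ γ X Y t)
  have hs' : ∀ p t, |s' p t| ≤ 8 := fun p t => by
    refine (abs_add_le _ _).trans ?_
    have h1 := abs_sin_mul_sub_cos_mul_le (γ p t) (meanCosDeriv μ γ X Y t) (meanSinDeriv μ γ X Y t)
    have h2 : |-fieldCos γ X Y p t * fieldSin γ X Y p t| ≤ 4 := by
      rw [abs_mul, abs_neg]
      nlinarith [h.abs_fieldSin_le p t, h.abs_fieldCos_le p t, abs_nonneg (fieldSin γ X Y p t),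
        abs_nonneg (fieldCos γ X Y p t)]
    linarith [h.abs_meanCosDeriv_le t, h.abs_meanSinDeriv_le t]
  have hbd : ∀ p t, |2 * fieldSin γ X Y p t * s' p t| ≤ 32 := fun p t => by
    rw [abs_mul, abs_mul, abs_two]
    nlinarith [hs' p t, h.abs_fieldSin_le p t, abs_nonneg (s' p t),
      abs_nonneg (fieldSin γ X Y p t)]
  have hS : ∀ t, 0 < t → HasDerivAt (fun t => ∫ p, fieldSin γ X Y p t ^ 2 ∂μ)
      (∫ p, 2 * fieldSin γ X Y p t * s' p t ∂μ) t := fun t ht =>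
    hasDerivAt_integral_of_abs_le (f' := fun p t => 2 * fieldSin γ X Y p t * s' p t) ht
      (fun t => (h.measurable_fieldSin t).pow_const 2)
      (fun t => ((h.measurable_fieldSin t).const_mul 2).mul
        (((h.measurable_fieldCos t).neg.mul (h.measurable_fieldSin t)).add
          (((h.measurable_sin t).mul_const _).sub ((h.measurable_cos t).mul_const _))))
      h.fieldSin_sq_le hbd
      fun p t ht => ((h.hasDerivAt_fieldSin p ht).fun_pow 2).congr_deriv (by
        simp only [s']; push_cast; ring)
  have := tendsto_zero_of_hasDerivAt_of_bounded (K := 2 * 32) (M := 2) h.continuous_normSq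
    (fun t ht => h.hasDerivAt_normSq ht) (fun t ht => (hS t ht).const_mul 2)
    (fun t => mul_nonneg zero_le_two (integral_fieldSin_sq_nonneg μ γ X Y t))
    (fun t _ => by
      rw [abs_mul, abs_two]
      exact mul_le_mul_of_nonneg_left (abs_integral_le_of_abs_le (hbd · t)) zero_le_two)
    (fun t => by
      nlinarith [sq_le_one_iff_abs_le_one (X t) |>.2 (h.abs_X_le t),
        sq_le_one_iff_abs_le_one (Y t) |>.2 (h.abs_Y_le t)])
  simpa using this.const_mul (2⁻¹ : ℝ)

theorem tendsto_meanDeriv (h : IsMeanFieldFlow μ γ X Y) :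
    Tendsto (fun t => |meanCosDeriv μ γ X Y t| + |meanSinDeriv μ γ X Y t|) atTop (𝓝 0) := by
  have hsqrt : Tendsto (fun t => √(∫ p, fieldSin γ X Y p t ^ 2 ∂μ)) atTop (𝓝 0) := by
    simpa using h.tendsto_integral_fieldSin_sq.sqrt
  refine squeeze_zero (fun t => by positivity)
    (fun t => add_le_add (Real.abs_le_sqrt (h.sq_meanCosDeriv_le t))
      (Real.abs_le_sqrt (h.sq_meanSinDeriv_le t))) ?_
  simpa using hsqrt.add hsqrt

/-- If the mean field does not vanish, some phase stays aligned with it and converges to its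
direction. -/
theorem exists_aligned (h : IsMeanFieldFlow μ γ X Y) (h0 : 0 < X 0 ^ 2 + Y 0 ^ 2) :
    ∃ r c₀ T, 0 < c₀ ∧ 0 < T ∧ (∀ t, T ≤ t → c₀ ≤ fieldCos γ X Y r t) ∧
      Tendsto (fieldSin γ X Y r) atTop (𝓝 0) := by
  set N₀ := X 0 ^ 2 + Y 0 ^ 2 with hN₀
  have hN : ∀ t, 0 ≤ t → N₀ ≤ X t ^ 2 + Y t ^ 2 := fun t ht =>
    h.monotoneOn_normSq self_mem_Ici ht ht
  have hN₀le : N₀ ≤ 2 := by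
    nlinarith [sq_le_one_iff_abs_le_one (X 0) |>.2 (h.abs_X_le 0),
      sq_le_one_iff_abs_le_one (Y 0) |>.2 (h.abs_Y_le 0)]
  obtain ⟨T₁, hT₁⟩ := eventually_atTop.1
    -- When `fieldCos = N₀ / 2`, one has `fieldSin² ≥ N₀ - N₀² / 4 ≥ N₀ / 2` because `N₀ ≤ 2`; a
    -- field velocity below `N₀ / 4` cannot then push `fieldCos` down through `N₀ / 2`.
    (h.tendsto_meanDeriv.eventually (gt_mem_nhds (show (0 : ℝ) < N₀ / 4 by positivity)))
  set T := max T₁ 1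
  have hT0 : 0 < T := one_pos.trans_le (le_max_right _ _)
  -- The average of `fieldCos` at time `T` is `X² + Y² ≥ N₀ > N₀ / 2`.
  obtain ⟨r, hr⟩ : ∃ r, N₀ / 2 ≤ fieldCos γ X Y r T := by
    by_contra! hcon
    have h1 : ∫ p, fieldCos γ X Y p T ∂μ ≤ ∫ _, N₀ / 2 ∂μ :=
      integral_mono (h.integrable_fieldCos T) (integrable_const _) fun p => (hcon p).le
    rw [h.integral_fieldCos] at h1
    simp at h1
    linarith [hN T hT0.le]
  have hcos : ∀ t, T ≤ t → N₀ / 2 ≤ fieldCos γ X Y r t := fun t ht =>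
    le_of_hasDerivAt_pos_of_eq (h.continuous_fieldCos r)
      (fun t ht => h.hasDerivAt_fieldCos r (hT0.trans_le ht)) hr (fun t ht hc => by
        have h1 := fieldSin_sq_add_fieldCos_sq γ X Y r t
        have h2 := hN t (hT0.le.trans ht)
        have h3 := abs_cos_mul_add_sin_mul_le (γ r t) (meanCosDeriv μ γ X Y t)
          (meanSinDeriv μ γ X Y t)
        have h4 := hT₁ t ((le_max_left _ _).trans ht)
        have h5 := neg_abs_le (Real.cos (γ r t) * meanCosDeriv μ γ X Y t +
          Real.sin (γ r t) * meanSinDeriv μ γ X Y t)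
        rw [hc] at h1
        nlinarith) ht
  refine ⟨r, N₀ / 2, T, by positivity, hT0, hcos, ?_⟩
  have hG := (h.tendsto_meanDeriv.pow 2).const_mul (1 / (N₀ / 2))
  rw [zero_pow two_ne_zero, mul_zero] at hG
  have hF := tendsto_zero_of_hasDerivAt_le (k := N₀ / 2) (T := T)
    (F := fun t => fieldSin γ X Y r t ^ 2) (by positivity) ((h.continuous_fieldSin r).pow 2)
    (fun t ht => (h.hasDerivAt_fieldSin r (hT0.trans ht)).fun_pow 2) (fun t => sq_nonneg _)
    (fun t ht => by
      have h1 := hcos t ht.le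
      have h2 := abs_sin_mul_sub_cos_mul_le (γ r t) (meanCosDeriv μ γ X Y t)
          (meanSinDeriv μ γ X Y t)
      set g := Real.sin (γ r t) * meanCosDeriv μ γ X Y t -
        Real.cos (γ r t) * meanSinDeriv μ γ X Y t
      set s := fieldSin γ X Y r t
      set b := |meanCosDeriv μ γ X Y t| + |meanSinDeriv μ γ X Y t|
      have h3 : g ^ 2 ≤ b ^ 2 := sq_le_sq' (by linarith [neg_abs_le g]) ((le_abs_self g).trans h2)
      -- Young's inequality gives up half of the damping `-N₀ s²` to absorb the forcing `g`.
      have h4 : 2 * (s * g) ≤ N₀ / 2 * s ^ 2 + 1 / (N₀ / 2) * g ^ 2 := by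
        have h5 : 0 ≤ (N₀ / 2 * s - g) ^ 2 * (1 / (N₀ / 2)) := by positivity
        have h6 : (N₀ / 2 * s - g) ^ 2 * (1 / (N₀ / 2)) =
            N₀ / 2 * s ^ 2 - 2 * (s * g) + 1 / (N₀ / 2) * g ^ 2 := by
          field_simp
          ring
        linarith
      have h7 : 1 / (N₀ / 2) * g ^ 2 ≤ 1 / (N₀ / 2) * b ^ 2 :=
        mul_le_mul_of_nonneg_left h3 (by positivity)
      have h8 := mul_le_mul_of_nonneg_right h1 (sq_nonneg s)
      push_cast
      simp only [pow_one]
      nlinarith) hG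
  rw [tendsto_zero_iff_abs_tendsto_zero]
  simpa [Real.sqrt_sq_eq_abs, Function.comp_def] using hF.sqrt

end IsMeanFieldFlow
end MeanField

/-! ### Relative phases -/

section Relative

variable {Ω : Type*} {γ : Ω → ℝ → ℝ} {X Y : ℝ → ℝ} {p r : Ω} {t : ℝ}

/-- `cot (δ / 2)` for the relative phase `δ = γ p - γ r`. -/
noncomputable def cotHalf (γ : Ω → ℝ → ℝ) (r p : Ω) (t : ℝ) : ℝ :=
  Real.sin (γ p t - γ r t) / (1 - Real.cos (γ p t - γ r t))

/-- The representative in `(0, 2π)` of the relative phase `γ p - γ r`. -/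
noncomputable def relPhase (γ : Ω → ℝ → ℝ) (r p : Ω) (t : ℝ) : ℝ :=
  Real.pi - 2 * Real.arctan (cotHalf γ r p t)

theorem fieldSin_eq_relative (γ : Ω → ℝ → ℝ) (X Y : ℝ → ℝ) (p r : Ω) (t : ℝ) :
    fieldSin γ X Y p t = fieldSin γ X Y r t * Real.cos (γ p t - γ r t) +
      fieldCos γ X Y r t * Real.sin (γ p t - γ r t) := by
  have h1 : Real.sin (γ p t) = Real.sin (γ r t + (γ p t - γ r t)) := by congr 1; ring
  have h2 : Real.cos (γ p t) = Real.cos (γ r t + (γ p t - γ r t)) := by congr 1; ring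
  simp only [fieldSin, fieldCos]
  rw [h1, h2, Real.sin_add, Real.cos_add]
  ring

/-- The equation is homogeneous linear in `1 - cos δ`. Hence distinct particles never collide, and
particles separate at most exponentially. -/
theorem hasDerivAt_one_sub_cos (hp : HasDerivAt (γ p) (-fieldSin γ X Y p t) t)
    (hr : HasDerivAt (γ r) (-fieldSin γ X Y r t) t) :
    HasDerivAt (fun t => 1 - Real.cos (γ p t - γ r t))
      ((fieldSin γ X Y r t * Real.sin (γ p t - γ r t) -
        fieldCos γ X Y r t * (1 + Real.cos (γ p t - γ r t))) *
        (1 - Real.cos (γ p t - γ r t))) t := by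
  refine ((hp.fun_sub hr).cos.const_sub 1).congr_deriv ?_
  rw [fieldSin_eq_relative γ X Y p r t]
  have := Real.sin_sq_add_cos_sq (γ p t - γ r t)
  linear_combination (-fieldCos γ X Y r t) * this

theorem one_add_cotHalf_sq (h : 1 - Real.cos (γ p t - γ r t) ≠ 0) :
    1 + cotHalf γ r p t ^ 2 = 2 / (1 - Real.cos (γ p t - γ r t)) := by
  have := Real.sin_sq_add_cos_sq (γ p t - γ r t)
  rw [cotHalf]
  field_simp
  linear_combination this

/-- Here `δ' = s (1 - cos δ) - c sin δ`, and the derivative of `cot (δ / 2)` is `-δ' / (1 - cos δ)`: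
the division leaves a linear equation. -/
theorem hasDerivAt_cotHalf (hp : HasDerivAt (γ p) (-fieldSin γ X Y p t) t)
    (hr : HasDerivAt (γ r) (-fieldSin γ X Y r t) t) (h : 1 - Real.cos (γ p t - γ r t) ≠ 0) :
    HasDerivAt (cotHalf γ r p)
      (fieldCos γ X Y r t * cotHalf γ r p t - fieldSin γ X Y r t) t := by
  refine ((hp.fun_sub hr).sin.div (hasDerivAt_one_sub_cos hp hr) h).congr_deriv ?_
  rw [fieldSin_eq_relative γ X Y p r t, cotHalf]
  have := Real.sin_sq_add_cos_sq (γ p t - γ r t)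
  generalize Real.sin (γ p t - γ r t) = S at *
  generalize Real.cos (γ p t - γ r t) = C at *
  generalize fieldSin γ X Y r t = s at *
  generalize fieldCos γ X Y r t = c at *
  field_simp
  linear_combination (-s) * this

theorem hasDerivAt_relPhase (hp : HasDerivAt (γ p) (-fieldSin γ X Y p t) t)
    (hr : HasDerivAt (γ r) (-fieldSin γ X Y r t) t) (h : 1 - Real.cos (γ p t - γ r t) ≠ 0) :
    HasDerivAt (relPhase γ r p) (fieldSin γ X Y r t - fieldSin γ X Y p t) t := by
  refine (((hasDerivAt_cotHalf hp hr h).arctan.const_mul 2).const_sub Real.pi).congr_deriv ?_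
  rw [one_add_cotHalf_sq h, fieldSin_eq_relative γ X Y p r t, cotHalf]
  field_simp
  ring

theorem relPhase_coe (h : 1 - Real.cos (γ p t - γ r t) ≠ 0) :
    (relPhase γ r p t : Real.Angle) = ((γ p t - γ r t : ℝ) : Real.Angle) := by
  have h1 := one_add_cotHalf_sq h
  have h2 : Real.cos (Real.arctan (cotHalf γ r p t)) ^ 2 = (1 - Real.cos (γ p t - γ r t)) / 2 := by
    rw [Real.cos_sq_arctan, h1, one_div_div]
  have h3 : Real.sin (Real.arctan (cotHalf γ r p t)) =
      cotHalf γ r p t * Real.cos (Real.arctan (cotHalf γ r p t)) := by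
    rw [← Real.tan_mul_cos (Real.cos_arctan_pos _).ne', Real.tan_arctan]
  apply Real.Angle.cos_sin_inj
  · rw [relPhase, Real.cos_pi_sub, Real.cos_two_mul, h2]
    ring
  · rw [relPhase, Real.sin_pi_sub, Real.sin_two_mul, h3]
    calc _ = 2 * cotHalf γ r p t * Real.cos (Real.arctan (cotHalf γ r p t)) ^ 2 := by ring
      _ = _ := by
        rw [h2, cotHalf]
        field_simp

theorem abs_relPhase_le (γ : Ω → ℝ → ℝ) (r p : Ω) (t : ℝ) : |relPhase γ r p t| ≤ 2 * Real.pi := by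
  have h1 := Real.arctan_lt_pi_div_two (cotHalf γ r p t)
  have h2 := Real.neg_pi_div_two_lt_arctan (cotHalf γ r p t)
  rw [relPhase, abs_le]
  constructor <;> linarith

end Relative

/-! ### Limits of the relative phases and of the aligned phase. -/

namespace IsMeanFieldFlow

variable {Ω : Type*} [MeasurableSpace Ω] {μ : Measure Ω} {γ : Ω → ℝ → ℝ} {X Y : ℝ → ℝ}

/-- The lifts `γ p` are arbitrary choices and need not be measurable in `p`; `relPhase` uses only
their sines and cosines. -/
theorem measurable_relPhase (h : IsMeanFieldFlow μ γ X Y) (r : Ω) (t : ℝ) :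
    Measurable fun p => relPhase γ r p t := by
  have hs := h.measurable_sin t
  have hc := h.measurable_cos t
  simp only [relPhase, cotHalf, Real.sin_sub, Real.cos_sub]
  fun_prop

variable [IsProbabilityMeasure μ]

theorem one_sub_cos_ne_zero (h : IsMeanFieldFlow μ γ X Y) {p r : Ω}
    (h0 : 1 - Real.cos (γ p 0 - γ r 0) ≠ 0) {t : ℝ} (ht : 0 ≤ t) :
    1 - Real.cos (γ p t - γ r t) ≠ 0 := by
  have hp := h.continuous p
  have hr := h.continuous r
  have hs := h.continuous_fieldSin r
  have hc := h.continuous_fieldCos r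
  exact ne_zero_of_hasDerivAt_mul (f := fun t => 1 - Real.cos (γ p t - γ r t)) (by fun_prop)
    (by fun_prop) (fun t ht => hasDerivAt_one_sub_cos (h.hasDerivAt p t ht) (h.hasDerivAt r t ht))
    h0 ht

/-- Since the mean of `γ` is conserved, `γ r` converges as soon as all the phases relative to it
do. -/
theorem exists_tendsto (h : IsMeanFieldFlow μ γ X Y) {r : Ω}
    (hne : ∀ p, p ≠ r → 1 - Real.cos (γ p 0 - γ r 0) ≠ 0)
    (hlim : ∀ p, p ≠ r → ∃ d, Tendsto (relPhase γ r p) atTop (𝓝 d)) :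
    ∃ l, Tendsto (γ r) atTop (𝓝 l) := by
  -- At `p = r` the quotient is `0 / 0 = 0`, so `relPhase` is the constant `π`. It matters if `μ`
  -- charges `r`, and is harmless because its derivative `0` is the expected one.
  have hrr : relPhase γ r r = fun _ => Real.pi := by
    ext t
    simp [relPhase, cotHalf]
  have hlim' : ∀ p, ∃ d, Tendsto (relPhase γ r p) atTop (𝓝 d) := fun p => by
    by_cases hp : p = r
    · rw [hp, hrr]
      exact ⟨_, tendsto_const_nhds⟩
    · exact hlim p hp
  choose d hd using hlim'
  have hmean : Tendsto (fun t => ∫ p, relPhase γ r p t ∂μ) atTop (𝓝 (∫ p, d p ∂μ)) :=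
    tendsto_integral_filter_of_dominated_convergence (fun _ => 2 * Real.pi)
      (Eventually.of_forall fun t => (h.measurable_relPhase r t).aestronglyMeasurable)
      (Eventually.of_forall fun t => ae_of_all _ fun p => abs_relPhase_le γ r p t)
      (integrable_const _) (ae_of_all _ hd)
  -- This sum stands in for the mean of `γ`, with a bounded measurable integrand.
  have hderiv : ∀ t, 0 < t → HasDerivAt (fun t => γ r t + ∫ p, relPhase γ r p t ∂μ) 0 t := by
    intro t ht
    have h1 : HasDerivAt (fun t => ∫ p, relPhase γ r p t ∂μ)
        (∫ p, (fieldSin γ X Y r t - fieldSin γ X Y p t) ∂μ) t :=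
      hasDerivAt_integral_of_abs_le (K := 4)
        (f' := fun p t => fieldSin γ X Y r t - fieldSin γ X Y p t) ht (h.measurable_relPhase r)
        (fun t => (h.measurable_fieldSin t).const_sub _) (fun p t => abs_relPhase_le γ r p t)
        (fun p t => (abs_sub _ _).trans
          (by linarith [h.abs_fieldSin_le p t, h.abs_fieldSin_le r t]))
        fun p t ht => by
          by_cases hp : p = r
          · rw [hp, hrr, sub_self]
            exact hasDerivAt_const t _
          · exact hasDerivAt_relPhase (h.hasDerivAt p t ht) (h.hasDerivAt r t ht)
              (h.one_sub_cos_ne_zero (hne p hp) ht.le)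
    refine ((h.hasDerivAt r t ht).add h1).congr_deriv ?_
    rw [integral_sub (integrable_const _) (h.integrable_fieldSin t), h.integral_fieldSin]
    simp
  have hconst : ∀ t, 1 ≤ t → γ r t + ∫ p, relPhase γ r p t ∂μ =
      γ r 1 + ∫ p, relPhase γ r p 1 ∂μ := fun t ht =>
    eq_of_hasDerivAt_zero_Ioi (f := fun t => γ r t + ∫ p, relPhase γ r p t ∂μ)
      (fun x hx => (hderiv x (one_pos.trans_le hx)).continuousAt.continuousWithinAt)
      (fun x hx => hderiv x (one_pos.trans hx)) ht
  refine ⟨γ r 1 + ∫ p, relPhase γ r p 1 ∂μ - ∫ p, d p ∂μ, (hmean.const_sub _).congr' ?_⟩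
  filter_upwards [eventually_ge_atTop 1] with t ht
  rw [← hconst t ht, add_sub_cancel_right]

/-- If the mean field does not vanish, there are an aligned phase `γ r`, which converges, and a
threshold `L` that decides, from the initial value of `cot (δ / 2)`, the limit of the phase relative
to `γ r`. -/
theorem exists_threshold (h : IsMeanFieldFlow μ γ X Y) (h0 : 0 < X 0 ^ 2 + Y 0 ^ 2)
    (hne : ∀ p q, p ≠ q → 1 - Real.cos (γ p 0 - γ q 0) ≠ 0) :
    ∃ r l L, Tendsto (γ r) atTop (𝓝 l) ∧ (∀ᶠ t in atTop, 0 < fieldCos γ X Y r t) ∧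
      Tendsto (fieldSin γ X Y r) atTop (𝓝 0) ∧ ∀ p, p ≠ r →
        (cotHalf γ r p 0 = L → Tendsto (relPhase γ r p) atTop (𝓝 Real.pi)) ∧
        (L < cotHalf γ r p 0 → Tendsto (relPhase γ r p) atTop (𝓝 0)) ∧
        (cotHalf γ r p 0 < L → Tendsto (relPhase γ r p) atTop (𝓝 (2 * Real.pi))) := by
  obtain ⟨r, c₀, T, hc₀, hT, hcos, hsin⟩ := h.exists_aligned h0
  obtain ⟨L, hL⟩ := exists_unstable_initial_value (h.continuous_fieldCos r)
    (h.continuous_fieldSin r) hc₀ hcos hsin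
  have key : ∀ p, p ≠ r →
      (cotHalf γ r p 0 = L → Tendsto (relPhase γ r p) atTop (𝓝 Real.pi)) ∧
      (L < cotHalf γ r p 0 → Tendsto (relPhase γ r p) atTop (𝓝 0)) ∧
      (cotHalf γ r p 0 < L → Tendsto (relPhase γ r p) atTop (𝓝 (2 * Real.pi))) := by
    intro p hpr
    have hp := h.continuous p
    have hr := h.continuous r
    have hcot : ContinuousOn (cotHalf γ r p) (Ici 0) :=
      ContinuousOn.div (by fun_prop) (by fun_prop) fun t ht =>
        h.one_sub_cos_ne_zero (hne p r hpr) ht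
    obtain ⟨h1, h2, h3⟩ := hL _ hcot fun t ht =>
      hasDerivAt_cotHalf (h.hasDerivAt p t ht) (h.hasDerivAt r t ht)
        (h.one_sub_cos_ne_zero (hne p r hpr) ht.le)
    have harctan : ∀ a, Tendsto (fun t => Real.arctan (cotHalf γ r p t)) atTop (𝓝 a) →
        Tendsto (relPhase γ r p) atTop (𝓝 (Real.pi - 2 * a)) := fun a ha =>
      (ha.const_mul 2).const_sub Real.pi
    refine ⟨fun hy => ?_, fun hy => ?_, fun hy => ?_⟩
    · simpa using harctan _ ((Real.continuous_arctan.tendsto 0).comp (h1 hy))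
    · convert harctan _ ((tendsto_nhds_of_tendsto_nhdsWithin Real.tendsto_arctan_atTop).comp
        (h2 hy)) using 2
      ring
    · convert harctan _ ((tendsto_nhds_of_tendsto_nhdsWithin Real.tendsto_arctan_atBot).comp
        (h3 hy)) using 2
      ring
  obtain ⟨l, hl⟩ := h.exists_tendsto (r := r) (fun p hp => hne p r hp) fun p hp => by
    obtain ⟨h1, h2, h3⟩ := key p hp
    rcases lt_trichotomy (cotHalf γ r p 0) L with hy | hy | hy
    exacts [⟨_, h3 hy⟩, ⟨_, h1 hy⟩, ⟨_, h2 hy⟩]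
  exact ⟨r, l, L, hl, eventually_atTop.2 ⟨T, fun t ht => hc₀.trans_le (hcos t ht)⟩, hsin, key⟩

end IsMeanFieldFlow

/-! ### Continuous branches of the phase -/

/-- The curve `X + i Y` avoids `0`, so it lifts through the covering map `exp`; the imaginary part
of the lift is the branch. -/
theorem exists_continuous_polar {X Y : ℝ → ℝ} (hX : Continuous X) (hY : Continuous Y)
    (h : ∀ t, 0 < X t ^ 2 + Y t ^ 2) :
    ∃ ψ : ℝ → ℝ, Continuous ψ ∧ ∀ t, √(X t ^ 2 + Y t ^ 2) * Real.cos (ψ t) = X t ∧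
      √(X t ^ 2 + Y t ^ 2) * Real.sin (ψ t) = Y t := by
  let g : C(ℝ, ℂ) := ⟨fun t => (X t : ℂ) + Y t * Complex.I, by fun_prop⟩
  have hg : ∀ t, g t ≠ 0 := fun t h0 => by
    have h1 := congrArg Complex.re h0
    have h2 := congrArg Complex.im h0
    simp [g] at h1 h2
    have := h t
    simp [h1, h2] at this
  obtain ⟨F, ⟨-, hF⟩, -⟩ := Complex.isCoveringMapOn_exp.existsUnique_continuousMap_lifts g
    (a₀ := 0) (e₀ := Complex.log (g 0)) (Complex.exp_log (hg 0)) hg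
  have hre : ∀ t, Real.exp (F t).re * Real.cos (F t).im = X t := fun t => by
    have := congrArg Complex.re (congrFun hF t)
    simpa [g, Complex.exp_re] using this
  have him : ∀ t, Real.exp (F t).re * Real.sin (F t).im = Y t := fun t => by
    have := congrArg Complex.im (congrFun hF t)
    simpa [g, Complex.exp_im] using this
  have hsqrt : ∀ t, √(X t ^ 2 + Y t ^ 2) = Real.exp (F t).re := fun t => by
    rw [← Real.sqrt_sq (Real.exp_pos (F t).re).le, ← hre, ← him]
    congr 1
    linear_combination (Real.exp (F t).re ^ 2) * Real.sin_sq_add_cos_sq (F t).im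
  exact ⟨fun t => (F t).im, Complex.continuous_im.comp F.continuous, fun t => by
    rw [hsqrt]
    exact ⟨hre t, him t⟩⟩

/-- A continuous real function whose sine tends to `0` while its cosine stays positive converges to
a multiple of `2π`. -/
theorem exists_tendsto_two_pi_mul_int {u : ℝ → ℝ} (hu : Continuous u)
    (hcos : ∀ᶠ t in atTop, 0 < Real.cos (u t))
    (hsin : Tendsto (fun t => Real.sin (u t)) atTop (𝓝 0)) :
    ∃ n : ℤ, Tendsto u atTop (𝓝 (2 * Real.pi * n)) := by
  obtain ⟨T, hT⟩ := eventually_atTop.1 hcos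
  -- Where `cos u > 0`, `u` and `arcsin (sin u)` agree mod `2π`; the quotient is continuous and
  -- integer valued, hence constant.
  have hmaps : MapsTo (fun t => (u t - Real.arcsin (Real.sin (u t))) / (2 * Real.pi)) (Ici T)
      (range ((↑) : ℤ → ℝ)) := fun t ht => by
    have h1 : (u t : Real.Angle) = (Real.arcsin (Real.sin (u t)) : ℝ) := by
      apply Real.Angle.cos_sin_inj
      · rw [Real.cos_arcsin, ← Real.abs_cos_eq_sqrt_one_sub_sin_sq, abs_of_pos (hT t ht)]
      · rw [Real.sin_arcsin (Real.neg_one_le_sin _) (Real.sin_le_one _)]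
    obtain ⟨k, hk⟩ := Real.Angle.angle_eq_iff_two_pi_dvd_sub.1 h1
    exact ⟨k, by
      dsimp only
      rw [hk, mul_div_cancel_left₀ _ Real.two_pi_pos.ne']⟩
  obtain ⟨n, hn⟩ := hmaps (self_mem_Ici (a := T))
  have hconst : ∀ t, T ≤ t → u t = 2 * Real.pi * n + Real.arcsin (Real.sin (u t)) :=
    fun t ht => by
      have h1 := isPreconnected_Ici.constant_of_mapsTo
        Int.isClosedEmbedding_coe_real.isInducing.isDiscrete_range
        (Continuous.continuousOn (by fun_prop)) hmaps (mem_Ici.2 ht) self_mem_Ici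
      dsimp only at h1 hn
      rw [← hn, div_eq_iff Real.two_pi_pos.ne'] at h1
      linarith
  refine ⟨n, Tendsto.congr' (f₁ := fun t => 2 * Real.pi * n + Real.arcsin (Real.sin (u t))) ?_ ?_⟩
  · filter_upwards [eventually_ge_atTop T] with t ht using (hconst t ht).symm
  · simpa using ((Real.continuous_arcsin.tendsto 0).comp hsin).const_add (2 * Real.pi * n)

/-- The fields at `r` are `R cos (ψ - γ r)` and `-R sin (ψ - γ r)`. As `R` stays above `R 0 > 0`,
dividing by it shows that `ψ - γ r` settles at a multiple of `2π`. -/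
theorem IsMeanFieldFlow.exists_continuous_branch {Ω : Type*} [MeasurableSpace Ω] {μ : Measure Ω}
    [IsProbabilityMeasure μ] {γ : Ω → ℝ → ℝ} {X Y : ℝ → ℝ} (h : IsMeanFieldFlow μ γ X Y)
    (hpos : ∀ t, 0 < X t ^ 2 + Y t ^ 2) {r : Ω} {l : ℝ} (hl : Tendsto (γ r) atTop (𝓝 l))
    (hcos : ∀ᶠ t in atTop, 0 < fieldCos γ X Y r t)
    (hsin : Tendsto (fieldSin γ X Y r) atTop (𝓝 0)) :
    ∃ (ψ : ℝ → ℝ) (n : ℤ), Continuous ψ ∧ Tendsto ψ atTop (𝓝 (l + 2 * Real.pi * n)) ∧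
      ∀ t, √(X t ^ 2 + Y t ^ 2) * Real.cos (ψ t) = X t ∧
        √(X t ^ 2 + Y t ^ 2) * Real.sin (ψ t) = Y t := by
  obtain ⟨ψ, hψ, hXY⟩ := exists_continuous_polar h.continuous_X h.continuous_Y hpos
  have hr := h.continuous r
  have hρ : ∀ t, 0 < √(X t ^ 2 + Y t ^ 2) := fun t => Real.sqrt_pos.2 (hpos t)
  have hc : ∀ t, fieldCos γ X Y r t = √(X t ^ 2 + Y t ^ 2) * Real.cos (ψ t - γ r t) := fun t => by
    rw [Real.cos_sub, fieldCos]
    linear_combination (-Real.cos (γ r t)) * (hXY t).1 - Real.sin (γ r t) * (hXY t).2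
  have hs : ∀ t, fieldSin γ X Y r t = -(√(X t ^ 2 + Y t ^ 2) * Real.sin (ψ t - γ r t)) :=
    fun t => by
      rw [Real.sin_sub, fieldSin]
      linear_combination (-Real.sin (γ r t)) * (hXY t).1 + Real.cos (γ r t) * (hXY t).2
  obtain ⟨n, hn⟩ := exists_tendsto_two_pi_mul_int (u := fun t => ψ t - γ r t) (by fun_prop)
    (hcos.mono fun t ht => by
      rw [hc] at ht
      exact pos_of_mul_pos_right ht (hρ t).le)
    (by
      have h1 := hsin.abs.mul_const (√(X 0 ^ 2 + Y 0 ^ 2))⁻¹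
      rw [abs_zero, zero_mul] at h1
      refine squeeze_zero_norm' ?_ h1
      filter_upwards [eventually_ge_atTop 0] with t ht
      have h2 : √(X 0 ^ 2 + Y 0 ^ 2) ≤ √(X t ^ 2 + Y t ^ 2) :=
        Real.sqrt_le_sqrt (h.monotoneOn_normSq self_mem_Ici ht ht)
      rw [hs, abs_neg, abs_mul, abs_of_pos (hρ t), Real.norm_eq_abs, ← div_eq_mul_inv,
        le_div_iff₀ (hρ 0), mul_comm]
      exact mul_le_mul_of_nonneg_right h2 (abs_nonneg _))
  exact ⟨ψ, n, hψ, (hl.add hn).congr fun t => by ring, hXY⟩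

/-! ### From weak solutions to mean-field flows -/

theorem Real.Angle.eq_of_one_sub_cos_sub_eq_zero {x y : ℝ} (h : 1 - Real.cos (x - y) = 0) :
    (x : Real.Angle) = y := by
  obtain ⟨n, hn⟩ := (Real.cos_eq_one_iff _).1 (sub_eq_zero.1 h).symm
  exact Real.Angle.angle_eq_iff_two_pi_dvd_sub.2 ⟨n, by rw [← hn]; ring⟩

theorem Real.cos_sub_cos_sq_le (x y : ℝ) :
    (Real.cos x - Real.cos y) ^ 2 ≤ 2 * (1 - Real.cos (x - y)) := by
  rw [Real.cos_sub]
  nlinarith [Real.sin_sq_add_cos_sq x, Real.sin_sq_add_cos_sq y,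
    sq_nonneg (Real.sin x - Real.sin y)]

theorem Real.sin_sub_sin_sq_le (x y : ℝ) :
    (Real.sin x - Real.sin y) ^ 2 ≤ 2 * (1 - Real.cos (x - y)) := by
  rw [Real.cos_sub]
  nlinarith [Real.sin_sq_add_cos_sq x, Real.sin_sq_add_cos_sq y,
    sq_nonneg (Real.cos x - Real.cos y)]

/-- Phases driven by a bounded field separate at most exponentially fast. -/
theorem one_sub_cos_le_exp {Ω : Type*} {γ : Ω → ℝ → ℝ} {X Y : ℝ → ℝ} {p r : Ω}
    (hX : ∀ t, |X t| ≤ 1) (hY : ∀ t, |Y t| ≤ 1) (hcp : Continuous (γ p)) (hcr : Continuous (γ r))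
    (hp : ∀ t, 0 < t → HasDerivAt (γ p) (-fieldSin γ X Y p t) t)
    (hr : ∀ t, 0 < t → HasDerivAt (γ r) (-fieldSin γ X Y r t) t) {t : ℝ} (ht : 0 ≤ t) :
    1 - Real.cos (γ p t - γ r t) ≤ (1 - Real.cos (γ p 0 - γ r 0)) * Real.exp (6 * t) := by
  -- The rate is at most `6`: `2` from `fieldSin * sin δ` and `4` from `fieldCos * (1 + cos δ)`.
  have hanti := antitoneOn_Ici_of_hasDerivAt_nonpos (a := 0)
    (f := fun t => (1 - Real.cos (γ p t - γ r t)) * Real.exp (-(6 * t))) (by fun_prop)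
    (fun t ht => (hasDerivAt_one_sub_cos (hp t ht) (hr t ht)).mul
      ((hasDerivAt_id t).const_mul 6).fun_neg.exp)
    (fun t _ => by
      have h1 : |fieldSin γ X Y r t| ≤ 2 :=
        (abs_sin_mul_sub_cos_mul_le _ _ _).trans (by linarith [hX t, hY t])
      have h2 : |fieldCos γ X Y r t| ≤ 2 :=
        (abs_cos_mul_add_sin_mul_le _ _ _).trans (by linarith [hX t, hY t])
      have h3 : fieldSin γ X Y r t * Real.sin (γ p t - γ r t) ≤ 2 := by
        refine (le_abs_self _).trans ?_
        rw [abs_mul]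
        nlinarith [Real.abs_sin_le_one (γ p t - γ r t), abs_nonneg (Real.sin (γ p t - γ r t)),
          abs_nonneg (fieldSin γ X Y r t)]
      have h4 : -(fieldCos γ X Y r t * (1 + Real.cos (γ p t - γ r t))) ≤ 4 := by
        nlinarith [Real.cos_le_one (γ p t - γ r t), Real.neg_one_le_cos (γ p t - γ r t),
          (abs_le.1 h2).1]
      have h5 : 0 ≤ (1 - Real.cos (γ p t - γ r t)) * Real.exp (-(6 * t)) :=
        mul_nonneg (sub_nonneg.2 (Real.cos_le_one _)) (Real.exp_pos _).le
      dsimp only [id]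
      nlinarith)
  have h1 := hanti self_mem_Ici ht ht
  simp only [mul_zero, neg_zero, Real.exp_zero, mul_one] at h1
  have h2 := mul_le_mul_of_nonneg_right h1 (Real.exp_pos (6 * t)).le
  rwa [mul_assoc, ← Real.exp_add, neg_add_cancel, Real.exp_zero, mul_one] at h2

/-- A function on the circle that is Lipschitz for the chordal distance is continuous. -/
theorem continuous_of_sq_sub_le {f : Real.Angle → ℝ} {K : ℝ}
    (h : ∀ x y, (f x - f y) ^ 2 ≤ K * (1 - Real.Angle.cos (x - y))) : Continuous f := by
  refine continuous_iff_continuousAt.2 fun y => ?_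
  have h1 : Continuous fun x : Real.Angle => √(K * (1 - Real.Angle.cos (x - y))) :=
    (continuous_const.mul (continuous_const.sub
      (Real.Angle.continuous_cos.comp (continuous_id.sub continuous_const)))).sqrt
  have h2 := h1.tendsto y
  simp only [sub_self, Real.Angle.cos_zero, mul_zero, Real.sqrt_zero] at h2
  exact tendsto_iff_norm_sub_tendsto_zero.2
    (squeeze_zero (fun _ => norm_nonneg _) (fun x => Real.abs_le_sqrt (h x y)) h2)

namespace IsKineticKuramotoSolution

variable {ρ₀ : Measure Real.Angle} {ρ : ℝ → Measure Real.Angle}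
  {Θ : ℝ → Real.Angle → Real.Angle} {R : ℝ → ℝ} {φ : ℝ → Real.Angle}

/-- Testing transport with `cos` and `sin` moves the order parameter onto `ρ₀`; `ρ t` plays no
further role. -/
theorem order_parameter_re_im (h : IsKineticKuramotoSolution ρ₀ ρ Θ R φ) {t : ℝ} (ht : 0 ≤ t) :
    R t * (φ t).cos = ∫ ϑ, (Θ t ϑ).cos ∂ρ₀ ∧ R t * (φ t).sin = ∫ ϑ, (Θ t ϑ).sin ∂ρ₀ := by
  have := h.isProbabilityMeasure t ht
  have hc : Integrable Real.Angle.cos (ρ t) :=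
    integrable_of_measurable_of_abs_le (K := 1) Real.Angle.continuous_cos.measurable fun ϑ => by
      induction ϑ using Real.Angle.induction_on
      exact Real.abs_cos_le_one _
  have hs : Integrable Real.Angle.sin (ρ t) :=
    integrable_of_measurable_of_abs_le (K := 1) Real.Angle.continuous_sin.measurable fun ϑ => by
      induction ϑ using Real.Angle.induction_on
      exact Real.abs_sin_le_one _
  have h1 := h.order_parameter t ht
  simp only [Real.Angle.coe_toCircle] at h1
  rw [integral_add hc.ofReal (hs.ofReal.mul_const _), integral_mul_const, integral_complex_ofReal,
    integral_complex_ofReal, h.transport t ht Real.Angle.cos Real.contDiff_cos,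
    h.transport t ht Real.Angle.sin Real.contDiff_sin] at h1
  have hre := congrArg Complex.re h1
  have him := congrArg Complex.im h1
  simp at hre him
  exact ⟨hre, him⟩

theorem exists_isMeanFieldFlow [IsProbabilityMeasure ρ₀]
    (h : IsKineticKuramotoSolution ρ₀ ρ Θ R φ) :
    ∃ γ : Real.Angle → ℝ → ℝ, (∀ ϑ t, 0 ≤ t → (γ ϑ t : Real.Angle) = Θ t ϑ) ∧
      IsMeanFieldFlow ρ₀ γ (fun t => R (max t 0) * (φ (max t 0)).cos)
        (fun t => R (max t 0) * (φ (max t 0)).sin) := by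
  choose γ hγ hd using h.characteristic
  set X : ℝ → ℝ := fun t => R (max t 0) * (φ (max t 0)).cos with hXdef
  set Y : ℝ → ℝ := fun t => R (max t 0) * (φ (max t 0)).sin with hYdef
  -- Freezing negative times at `0` turns continuity on `[0, ∞)` into continuity on `ℝ`.
  let Γ : Real.Angle → ℝ → ℝ := fun ϑ t => γ ϑ (max t 0)
  have hm : ∀ t : ℝ, 0 ≤ max t 0 := fun t => le_max_right t 0
  have hX : ∀ t, X t = ∫ ϑ, Real.cos (Γ ϑ t) ∂ρ₀ := fun t => by
    simp only [hXdef, Γ, ← Real.Angle.cos_coe, hγ _ _ (hm t)]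
    exact (h.order_parameter_re_im (hm t)).1
  have hY : ∀ t, Y t = ∫ ϑ, Real.sin (Γ ϑ t) ∂ρ₀ := fun t => by
    simp only [hYdef, Γ, ← Real.Angle.sin_coe, hγ _ _ (hm t)]
    exact (h.order_parameter_re_im (hm t)).2
  -- This bound needs no measurability of the integrand. Measurability comes later: the bounded
  -- field makes `Θ t` depend continuously on the initial phase.
  have hX1 : ∀ t, |X t| ≤ 1 := fun t => by
    rw [hX]
    exact abs_integral_le_of_abs_le fun _ => Real.abs_cos_le_one _
  have hY1 : ∀ t, |Y t| ≤ 1 := fun t => by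
    rw [hY]
    exact abs_integral_le_of_abs_le fun _ => Real.abs_sin_le_one _
  have hcont : ∀ ϑ, Continuous (Γ ϑ) := fun ϑ => by
    have h1 : ContinuousOn (γ ϑ) (Ici 0) := fun t ht => (hd ϑ t ht).continuousWithinAt
    exact h1.comp_continuous (by fun_prop) hm
  have hderiv : ∀ ϑ t, 0 < t → HasDerivAt (Γ ϑ) (-fieldSin Γ X Y ϑ t) t := fun ϑ t ht => by
    have h1 := (hd ϑ t ht.le).hasDerivAt (Ici_mem_nhds ht)
    refine (h1.congr_of_eventuallyEq ?_).congr_deriv ?_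
    · filter_upwards [Ioi_mem_nhds ht] with τ hτ
      simp only [Γ, max_eq_left (mem_Ioi.1 hτ).le]
    · simp only [fieldSin, Γ, hXdef, hYdef, max_eq_left ht.le]
      rw [sub_eq_add_neg (γ ϑ t : Real.Angle), Real.Angle.sin_add, Real.Angle.sin_neg,
        Real.Angle.cos_neg, Real.Angle.sin_coe, Real.Angle.cos_coe]
      ring
  have hdist : ∀ t x y, 1 - Real.cos (Γ x t - Γ y t) ≤
      Real.exp (6 * max t 0) * (1 - Real.Angle.cos (x - y)) := fun t x y => by
    have h1 := one_sub_cos_le_exp hX1 hY1 (hcont x) (hcont y) (hderiv x) (hderiv y) (hm t)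
    have h2 : ∀ ϑ, (Γ ϑ 0 : Real.Angle) = ϑ := fun ϑ => by
      simp only [Γ, max_self, hγ ϑ 0 le_rfl, h.initial]
    have h3 : Real.cos (Γ x 0 - Γ y 0) = Real.Angle.cos (x - y) := by
      rw [← Real.Angle.cos_coe, Real.Angle.coe_sub, h2, h2]
    rw [h3, mul_comm] at h1
    simpa only [Γ, max_eq_left (hm t)] using h1
  refine ⟨Γ, fun ϑ t ht => ?_, hcont, hderiv, fun t => ?_, fun t => ?_, hX, hY⟩
  · simp only [Γ, max_eq_left ht, hγ ϑ t ht]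
  · refine (continuous_of_sq_sub_le (K := 2 * Real.exp (6 * max t 0)) fun x y => ?_).measurable
    linarith [hdist t x y, Real.sin_sub_sin_sq_le (Γ x t) (Γ y t)]
  · refine (continuous_of_sq_sub_le (K := 2 * Real.exp (6 * max t 0)) fun x y => ?_).measurable
    linarith [hdist t x y, Real.cos_sub_cos_sq_le (Γ x t) (Γ y t)]

end IsKineticKuramotoSolution

/-! ### Convergence of the weak solution. -/

theorem proposition3p3 (ρ₀ : Measure Real.Angle) [IsProbabilityMeasure ρ₀]
    (ρ : ℝ → Measure Real.Angle) (Θ : ℝ → Real.Angle → Real.Angle)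
    (R : ℝ → ℝ) (φ : ℝ → Real.Angle)
    (hsol : IsKineticKuramotoSolution ρ₀ ρ Θ R φ)
    (hR : ∃ t, 0 ≤ t ∧ R t ≠ 0) :
    (∀ t, 0 ≤ t → 0 < R t) ∧
    ∃ (ψ : ℝ → ℝ) (φstar : ℝ),
      ContinuousOn ψ (Ici 0) ∧ (∀ t, 0 ≤ t → (ψ t : Real.Angle) = φ t) ∧
      Tendsto ψ atTop (𝓝 φstar) ∧
      ∃ α : Real.Angle,
        (∀ ϑ : Real.Angle, ϑ ≠ α →
          Tendsto (fun t => Θ t ϑ) atTop (𝓝 (φstar : Real.Angle))) ∧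
        Tendsto (fun t => Θ t α) atTop (𝓝 ((φstar + Real.pi : ℝ) : Real.Angle)) := by
  obtain ⟨γ, hγ, hflow⟩ := hsol.exists_isMeanFieldFlow
  set X : ℝ → ℝ := fun t => R (max t 0) * (φ (max t 0)).cos with hX
  set Y : ℝ → ℝ := fun t => R (max t 0) * (φ (max t 0)).sin with hY
  have hN : ∀ t, X t ^ 2 + Y t ^ 2 = R (max t 0) ^ 2 := fun t => by
    linear_combination R (max t 0) ^ 2 * Real.Angle.cos_sq_add_sin_sq (φ (max t 0))
  obtain ⟨t₀, ht₀, hRt₀⟩ := hR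
  have h0 : 0 < X 0 ^ 2 + Y 0 ^ 2 := hflow.normSq_zero_pos ht₀ (by
    rw [hN, max_eq_left ht₀]
    positivity)
  have hpos : ∀ t, 0 < X t ^ 2 + Y t ^ 2 := fun t => by
    have h1 := h0.trans_le
      (hflow.monotoneOn_normSq self_mem_Ici (mem_Ici.2 (le_max_right t 0)) (le_max_right t 0))
    simpa only [hN, max_eq_left (le_max_right t 0)] using h1
  have hRpos : ∀ t, 0 ≤ t → 0 < R t := fun t ht => by
    have h1 := hpos t
    rw [hN, max_eq_left ht] at h1
    exact (hsol.R_nonneg t ht).lt_of_ne' (pow_ne_zero_iff two_ne_zero |>.1 h1.ne')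
  have hγ0 : ∀ ϑ, (γ ϑ 0 : Real.Angle) = ϑ := fun ϑ => by rw [hγ ϑ 0 le_rfl, hsol.initial]
  have hne : ∀ p q, p ≠ q → 1 - Real.cos (γ p 0 - γ q 0) ≠ 0 := fun p q hpq hcos =>
    hpq (by simpa only [hγ0] using Real.Angle.eq_of_one_sub_cos_sub_eq_zero hcos)
  obtain ⟨r, l, L, hl, hcos, hsin, hlim⟩ := hflow.exists_threshold h0 hne
  obtain ⟨ψ, n, hψ, hψlim, hpolar⟩ := hflow.exists_continuous_branch hpos hl hcos hsin
  have hcoe : ((l + 2 * Real.pi * n : ℝ) : Real.Angle) = l :=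
    Real.Angle.angle_eq_iff_two_pi_dvd_sub.2 ⟨n, by ring⟩
  refine ⟨hRpos, ψ, l + 2 * Real.pi * n, hψ.continuousOn, fun t ht => ?_, hψlim, ?_⟩
  · obtain ⟨h1, h2⟩ := hpolar t
    rw [hN, max_eq_left ht, Real.sqrt_sq (hRpos t ht).le] at h1 h2
    simp only [hX, hY, max_eq_left ht] at h1 h2
    have h1' := mul_left_cancel₀ (hRpos t ht).ne' h1
    have h2' := mul_left_cancel₀ (hRpos t ht).ne' h2
    generalize φ t = θ at h1' h2' ⊢
    induction θ using Real.Angle.induction_on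
    exact Real.Angle.cos_sin_inj h1' h2'
  have hΘ : ∀ p d, p ≠ r → Tendsto (relPhase γ r p) atTop (𝓝 d) →
      Tendsto (fun t => Θ t p) atTop (𝓝 ((l + d : ℝ) : Real.Angle)) := fun p d hpr hd => by
    refine ((Real.Angle.continuous_coe.tendsto _).comp (hl.add hd)).congr' ?_
    filter_upwards [eventually_ge_atTop 0] with t ht
    simp only [Function.comp_apply]
    rw [Real.Angle.coe_add, relPhase_coe (hflow.one_sub_cos_ne_zero (hne p r hpr) ht),
      ← Real.Angle.coe_add, add_sub_cancel, hγ p t ht]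
  have hcosL := Real.cos_arctan_pos L
  -- The solution of `cot (δ / 2) = L` in `(0, 2π)` is `δ = π - 2 arctan L`.
  set α : Real.Angle := ((γ r 0 + (Real.pi - 2 * Real.arctan L) : ℝ) : Real.Angle) with hα
  have hrel : ((γ α 0 - γ r 0 : ℝ) : Real.Angle) = ((Real.pi - 2 * Real.arctan L : ℝ)) := by
    rw [Real.Angle.coe_sub, hγ0 α, hα, Real.Angle.coe_add, add_sub_cancel_left]
  have hαcos : Real.cos (γ α 0 - γ r 0) = 1 - 2 * Real.cos (Real.arctan L) ^ 2 := by
    rw [← Real.Angle.cos_coe, hrel, Real.Angle.cos_coe, Real.cos_pi_sub, Real.cos_two_mul]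
    ring
  have hαsin : Real.sin (γ α 0 - γ r 0) =
      2 * Real.sin (Real.arctan L) * Real.cos (Real.arctan L) := by
    rw [← Real.Angle.sin_coe, hrel, Real.Angle.sin_coe, Real.sin_pi_sub, Real.sin_two_mul]
  have hαr : α ≠ r := fun hαr => by
    rw [hαr, sub_self, Real.cos_zero] at hαcos
    nlinarith
  have hαcot : cotHalf γ r α 0 = L := by
    rw [cotHalf, hαcos, hαsin, sub_sub_cancel]
    conv_rhs => rw [← Real.tan_arctan L, Real.tan_eq_sin_div_cos]
    field_simp
  refine ⟨α, fun p hp => ?_, ?_⟩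
  · rw [hcoe]
    by_cases hpr : p = r
    · refine ((Real.Angle.continuous_coe.tendsto _).comp hl).congr' ?_
      filter_upwards [eventually_ge_atTop 0] with t ht
      rw [Function.comp_apply, hpr, hγ r t ht]
    · rcases lt_trichotomy (cotHalf γ r p 0) L with hy | hy | hy
      · have := hΘ p _ hpr ((hlim p hpr).2.2 hy)
        rwa [Real.Angle.coe_add, Real.Angle.coe_two_pi, add_zero] at this
      -- The value of `cot (δ / 2)` determines `δ` mod `2π`, so only `α` starts at the threshold.
      · refine absurd ?_ hp
        have h1 := relPhase_coe (hne p r hpr)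
        rw [relPhase, hy] at h1
        rw [hα, Real.Angle.coe_add, h1, ← Real.Angle.coe_add, add_sub_cancel, hγ0]
      · have := hΘ p _ hpr ((hlim p hpr).2.1 hy)
        rwa [add_zero] at this
  · rw [Real.Angle.coe_add, hcoe, ← Real.Angle.coe_add]
    exact hΘ α _ hαr ((hlim α hαr).1 hαcot)
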